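/- Let $\varphi: R\to S$ be a flat ring homomorphism of finite type between excellent (commutative) rings. Assume that for every maximal ideal $P$ of $S$ the contraction $\varphi^{-1}(P)$ is a maximal ideal of $R$, and that all closed fibers of $\varphi$ are geometrically seminormal, i.e. for every maximal ideal $\mathfrak m$ of $R$ and every finite field extension $L$ of the residue field $\kappa(\mathfrak m)=R/\mathfrak m$, the ring $L\otimes_{\kappa(\mathfrak m)}(\kappa(\mathfrak m)\otimes_R S)$ is seminormal. Then $\varphi$ is a seminormal homomorphism, i.e. $\varphi$ is flat and for every prime ideal $\mathfrak p$ of $R$ and every finite field extension $L$ of the residue field $\kappa(\mathfrak p)$, the ring $L\otimes_{\kappa(\mathfrak p)}(\kappa(\mathfrak p)\otimes_R S)$ is seminormal. Here a Noetherian ring $A$ is called seminormal if it is reduced and, with $\overline A$ its integral closure in its total ring of fractions, every $b\in\overline A$ whose image in $\overline A_{\mathfrak p}$ lies in $A_{\mathfrak p}+J(\overline A_{\mathfrak p})$ for all primes $\mathfrak p$ of $A$ belongs to $A$ ($J$ denotes the Jacobson radical and $\overline A_{\mathfrak p}$ the localization of $\overline A$ at $A\setminus\mathfrak p$). A commutative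 ring $A$ is called excellent if it is Noetherian, universally catenary, a G-ring (for each prime $\mathfrak p$ of $A$ the fibers of the completion map $A_{\mathfrak p}\to\widehat{A_{\mathfrak p}}$ remain regular rings after every finite extension of the respective residue field), and J-2 (every finite type algebra over it has open regular locus). -/

import Mathlib

universe u v

open scoped TensorProduct

/-! ### Excellent rings -/

/-- A commutative ring is catenary if any two saturated chains of prime ideals with the same
end points have the same length. (This is used for Noetherian rings only, where every chain of
primes is finite and refines to a saturated one.) -/
def IsCatenaryRing (R : Type u) [CommRing R] : Prop :=
  ∀ c d : RelSeries {x : PrimeSpectrum R × PrimeSpectrum R | x.1 ⋖ x.2},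
    c.head = d.head → c.last = d.last → c.length = d.length

/-- `R` is universally catenary if every finite type `R`-algebra is catenary. -/
def IsUniversallyCatenaryRing (R : Type u) [CommRing R] : Prop :=
  ∀ (A : Type u) [CommRing A] [Algebra R A], Algebra.FiniteType R A → IsCatenaryRing A

/-- The regular locus of a ring: the primes at which the local ring is regular. -/
def regularLocus (R : Type u) [CommRing R] : Set (PrimeSpectrum R) :=
  {p | IsRegularLocalRing (Localization.AtPrime p.asIdeal)}

/-- `R` is J-2 if every finite type `R`-algebra has open regular locus. -/
def IsJTwoRing (R : Type u) [CommRing R] : Prop :=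
  ∀ (A : Type u) [CommRing A] [Algebra R A], Algebra.FiniteType R A → IsOpen (regularLocus A)

/-- A `k`-algebra `A` over a field is geometrically regular if `L ⊗[k] A` is a regular
(Noetherian) ring for every finite field extension `L` of `k`. -/
def IsGeometricallyRegular (k : Type u) (A : Type v) [Field k] [CommRing A] [Algebra k A] :
    Prop :=
  ∀ (L : Type u) [Field L] [Algebra k L], FiniteDimensional k L → IsRegularRing (L ⊗[k] A)

/-- The completion of a local ring with respect to its maximal ideal. -/
abbrev LocalCompletion (R : Type u) [CommRing R] [IsLocalRing R] : Type u :=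
  AdicCompletion (IsLocalRing.maximalIdeal R) R

/-- `R` is a G-ring if for every prime `p` all the formal fibers of the local ring `R_p`, that is
the fibers of `R_p → (R_p)^`, are geometrically regular. -/
def IsGrothendieckRing (R : Type u) [CommRing R] : Prop :=
  ∀ (p : Ideal R) [p.IsPrime] (q : Ideal (Localization.AtPrime p)) [q.IsPrime],
    IsGeometricallyRegular q.ResidueField (q.Fiber (LocalCompletion (Localization.AtPrime p)))

/-- Excellent rings: Noetherian, universally catenary, J-2 and G-rings. -/
structure IsExcellentRing (R : Type u) [CommRing R] : Prop where
  isNoetherianRing : IsNoetherianRing R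
  isUniversallyCatenaryRing : IsUniversallyCatenaryRing R
  isJTwoRing : IsJTwoRing R
  isGrothendieckRing : IsGrothendieckRing R

/-! ### Seminormal rings -/

/-- The localization `B_p` of an `A`-algebra `B` at a prime `p` of `A`. -/
abbrev LocalizationOver {A : Type u} (B : Type v) [CommRing A] [CommRing B] [Algebra A B]
    (p : Ideal A) [p.IsPrime] : Type v :=
  Localization (Algebra.algebraMapSubmonoid B p.primeCompl)

/-- Traverso's seminormalization of `A` in an (integral) extension `B`: the subalgebra of all
`b : B` such that `b_p ∈ A_p + J(B_p)` for every prime `p` of `A`, where `J` is the Jacobson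
radical. -/
def seminormalizationIn (A : Type u) (B : Type v) [CommRing A] [CommRing B] [Algebra A B] :
    Subalgebra A B where
  carrier := {b | ∀ (p : Ideal A) [p.IsPrime], ∃ a : Localization.AtPrime p,
    ∃ j ∈ (⊥ : Ideal (LocalizationOver B p)).jacobson,
      algebraMap B (LocalizationOver B p) b =
        algebraMap (Localization.AtPrime p) (LocalizationOver B p) a + j}
  mul_mem' := by
    intro x y hx hy p _
    obtain ⟨a, j, hj, h⟩ := hx p
    obtain ⟨a', j', hj', h'⟩ := hy p
    refine ⟨a * a', algebraMap _ (LocalizationOver B p) a * j' +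
      (algebraMap _ (LocalizationOver B p) a' + j') * j,
      add_mem (Ideal.mul_mem_left _ _ hj') (Ideal.mul_mem_left _ _ hj), ?_⟩
    rw [map_mul, map_mul, h, h']
    ring
  add_mem' := by
    intro x y hx hy p _
    obtain ⟨a, j, hj, h⟩ := hx p
    obtain ⟨a', j', hj', h'⟩ := hy p
    refine ⟨a + a', j + j', add_mem hj hj', ?_⟩
    rw [map_add, map_add, h, h']
    ring
  algebraMap_mem' := by
    intro r p _
    refine ⟨algebraMap A _ r, 0, zero_mem _, ?_⟩
    rw [add_zero, ← IsScalarTower.algebraMap_apply, ← IsScalarTower.algebraMap_apply]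

/-- The normalization of `A`: its integral closure in its total ring of fractions (the
localization of `A` at the set of all non-zero-divisors). -/
abbrev Normalization (A : Type u) [CommRing A] : Type u :=
  integralClosure A (FractionRing A)

/-- A (Noetherian) ring is seminormal if it is reduced and equal to its seminormalization in its
normalization. -/
def IsSeminormalRing (A : Type u) [CommRing A] : Prop :=
  IsReduced A ∧ seminormalizationIn A (Normalization A) = ⊥

/-- A `k`-algebra `A` over a field is geometrically seminormal if `L ⊗[k] A` is seminormal for
every finite field extension `L` of `k`. -/
def IsGeometricallySeminormal (k : Type u) (A : Type v) [Field k] [CommRing A] [Algebra k A] :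
    Prop :=
  ∀ (L : Type u) [Field L] [Algebra k L], FiniteDimensional k L → IsSeminormalRing (L ⊗[k] A)

/-- The structure map `R → S` is a seminormal homomorphism: it is flat, and for every prime `p`
of `R` the fiber `κ(p) ⊗[R] S` stays seminormal after every finite field extension of `κ(p)`. -/
structure IsSeminormalHom (R : Type u) (S : Type v) [CommRing R] [CommRing S] [Algebra R S] :
    Prop where
  flat : Module.Flat R S
  fiber : ∀ (p : Ideal R) [p.IsPrime], IsGeometricallySeminormal p.ResidueField (p.Fiber S)

/-! ### Swan's criterion -/

/-- Swan's form of seminormality: `A` is reduced and every solution of `b ^ 2 = c ^ 3` is of the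
form `(a ^ 3, a ^ 2)`. -/
def IsSwanSeminormal (A : Type*) [CommRing A] : Prop :=
  IsReduced A ∧ ∀ b c : A, b ^ 2 = c ^ 3 → ∃ a, a ^ 2 = c ∧ a ^ 3 = b

/-- Swan's form of seminormality of the localization of `A` at `P`, expressed in `A`. -/
def IsSwanSeminormalAt (A : Type*) [CommRing A] (P : Ideal A) : Prop :=
  (∀ z : A, z ^ 2 = 0 → ∃ h ∉ P, h * z = 0) ∧
    ∀ b c : A, b ^ 2 = c ^ 3 → ∃ h ∉ P, ∃ a, a ^ 2 = h ^ 2 * c ∧ a ^ 3 = h ^ 3 * b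

section Swan

variable {A B : Type*} [CommRing A] [CommRing B]

lemma eq_of_sq_eq_of_cube_eq [IsReduced A] {a b : A} (h2 : a ^ 2 = b ^ 2) (h3 : a ^ 3 = b ^ 3) :
    a = b := by
  have : (a - b) ^ 3 = 0 := by linear_combination (4 : A) * h3 + (-3 * b - 3 * a) * h2
  exact sub_eq_zero.1 (eq_zero_of_pow_eq_zero this)

lemma eq_zero_of_sq_eq_zero [IsReduced A] {a : A} (h : a ^ 2 = 0) : a = 0 :=
  eq_zero_of_pow_eq_zero h

/-- The linear form of Swan's criterion. -/
lemma sq_eq_and_cube_eq_of_mul_eq [IsReduced A] {a b c h : A} (hbc : b ^ 2 = c ^ 3)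
    (hab : c * a = h * b) (hann : ∀ r, r * c = 0 → r * a = 0) :
    a ^ 2 = h ^ 2 * c ∧ a ^ 3 = h ^ 3 * b := by
  have h1 : (a ^ 2 - h ^ 2 * c) * c = 0 := by
    apply eq_zero_of_sq_eq_zero
    linear_combination (a ^ 2 - h ^ 2 * c) * ((c * a + h * b) * hab + h ^ 2 * hbc)
  have h2 := hann _ h1
  have h3 : a ^ 2 - h ^ 2 * c = 0 := by
    apply eq_zero_of_sq_eq_zero
    linear_combination a * h2 - h ^ 2 * h1
  exact ⟨by linear_combination h3, by linear_combination a * h3 + h ^ 2 * hab⟩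

lemma mul_eq_and_ann_of_sq_eq [IsReduced A] {a b c h : A}
    (h2 : a ^ 2 = h ^ 2 * c) (h3 : a ^ 3 = h ^ 3 * b) :
    c * (h ^ 2 * a) = h ^ 3 * b ∧ ∀ r, r * c = 0 → r * (h ^ 2 * a) = 0 := by
  refine ⟨by linear_combination h3 - a * h2, fun r hr ↦ eq_zero_of_sq_eq_zero ?_⟩
  linear_combination r ^ 2 * h ^ 4 * h2 + r * h ^ 6 * hr

/-- The ideal of denominators of the element `b / c` of the total ring of fractions. -/
def cuspDenominators (b c : A) : Ideal A where
  carrier := {h | ∃ a, c * a = h * b ∧ ∀ r, r * c = 0 → r * a = 0}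
  zero_mem' := ⟨0, by simp, by simp⟩
  add_mem' := by
    rintro h h' ⟨a, h1, h2⟩ ⟨a', h1', h2'⟩
    exact ⟨a + a', by linear_combination h1 + h1', fun r hr ↦ by
      rw [mul_add, h2 r hr, h2' r hr, add_zero]⟩
  smul_mem' := by
    rintro s h ⟨a, h1, h2⟩
    exact ⟨s * a, by rw [smul_eq_mul]; linear_combination s * h1, fun r hr ↦ by
      linear_combination s * h2 r hr⟩

lemma mem_cuspDenominators {b c h : A} :
    h ∈ cuspDenominators b c ↔ ∃ a, c * a = h * b ∧ ∀ r, r * c = 0 → r * a = 0 := Iff.rfl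

lemma IsReduced.of_sq_eq_zero (h : ∀ z : A, z ^ 2 = 0 → z = 0) : IsReduced A :=
  (isReduced_iff_pow_one_lt 2 one_lt_two).2 h

theorem isSwanSeminormal_of_forall_isMaximal
    (h : ∀ P : Ideal A, P.IsMaximal → IsSwanSeminormalAt A P) : IsSwanSeminormal A := by
  have hred : IsReduced A := by
    refine IsReduced.of_sq_eq_zero fun z hz ↦ ?_
    have : Ideal.span {z} ≤ ⊥ := by
      rw [Ideal.span_singleton_le_iff_mem]
      by_contra hne
      have hI : (LinearMap.ker (LinearMap.toSpanSingleton A A z) : Ideal A) ≠ ⊤ := by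
        intro h1
        apply hne
        have := (Ideal.eq_top_iff_one _).1 h1
        simpa using this
      obtain ⟨P, hP, hle⟩ := Ideal.exists_le_maximal _ hI
      obtain ⟨s, hs, hsz⟩ := (h P hP).1 z hz
      exact hs (hle (by simpa using hsz))
    simpa using this
  refine ⟨hred, fun b c hbc ↦ ?_⟩
  have htop : cuspDenominators b c = ⊤ := by
    by_contra hI
    obtain ⟨P, hP, hle⟩ := Ideal.exists_le_maximal _ hI
    obtain ⟨s, hs, a, h2, h3⟩ := (h P hP).2 b c hbc
    have := mul_eq_and_ann_of_sq_eq h2 h3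
    exact hs (hP.isPrime.mem_of_pow_mem 3 (hle ⟨_, this⟩))
  obtain ⟨a, h1, h2⟩ := mem_cuspDenominators.1 ((Ideal.eq_top_iff_one _).1 htop)
  obtain ⟨h3, h4⟩ := sq_eq_and_cube_eq_of_mul_eq hbc h1 h2
  exact ⟨a, by simpa using h3, by simpa using h4⟩

theorem IsSwanSeminormal.of_ringEquiv (e : A ≃+* B) (h : IsSwanSeminormal A) :
    IsSwanSeminormal B := by
  have := h.1
  refine ⟨isReduced_of_injective e.symm e.symm.injective, fun b c hbc ↦ ?_⟩
  obtain ⟨a, h2, h3⟩ := h.2 (e.symm b) (e.symm c) (by rw [← map_pow, ← map_pow, hbc])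
  exact ⟨e a, by rw [← map_pow, h2, e.apply_symm_apply], by
    rw [← map_pow, h3, e.apply_symm_apply]⟩

/-- Swan's condition descends along a ring homomorphism that is split as a map of modules. -/
theorem IsSwanSeminormal.of_retraction (i : A →+* B) (ρ : B →+ A)
    (hρ : ∀ a x, ρ (i a * x) = a * ρ x) (hρ1 : ρ 1 = 1) (h : IsSwanSeminormal B) :
    IsSwanSeminormal A := by
  have hi : Function.LeftInverse ρ i := fun a ↦ by
    rw [← mul_one (i a), hρ, hρ1, mul_one]
  have := h.1
  have hA : IsReduced A := isReduced_of_injective i hi.injective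
  refine ⟨hA, fun b c hbc ↦ ?_⟩
  obtain ⟨a, h2, h3⟩ := h.2 (i b) (i c) (by rw [← map_pow, ← map_pow, hbc])
  obtain ⟨h4, h5⟩ := mul_eq_and_ann_of_sq_eq (a := a) (h := 1) (by simpa using h2)
    (by simpa using h3)
  simp only [one_pow, one_mul] at h4 h5
  obtain ⟨h6, h7⟩ := sq_eq_and_cube_eq_of_mul_eq (a := ρ a) (h := 1) hbc
    (by rw [← hρ, h4, hi, one_mul])
    (fun r hr ↦ by rw [← hρ, h5 (i r) (by rw [← map_mul, hr, map_zero]), map_zero])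
  exact ⟨ρ a, by simpa using h6, by simpa using h7⟩

theorem IsSwanSeminormal.isLocalization [Algebra A B] (M : Submonoid A) [IsLocalization M B]
    (h : IsSwanSeminormal A) : IsSwanSeminormal B := by
  have hA := h.1
  have hB : IsReduced B := by
    refine IsReduced.of_sq_eq_zero fun z hz ↦ ?_
    obtain ⟨⟨z', s⟩, hs⟩ := IsLocalization.surj M z
    simp only at hs
    obtain ⟨v, hv⟩ := (IsLocalization.eq_iff_exists M B).1
      (show algebraMap A B (z' ^ 2) = algebraMap A B 0 by rw [map_pow, ← hs, map_zero, mul_pow, hz,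
        zero_mul])
    have h1 : (v : A) * z' = 0 := eq_zero_of_sq_eq_zero (by linear_combination (v : A) * hv)
    have h2 := congrArg (algebraMap A B) h1
    rw [map_mul, ← hs, map_zero, (IsLocalization.map_units B v).mul_right_eq_zero] at h2
    exact (IsLocalization.map_units B s).mul_left_eq_zero.1 h2
  refine ⟨hB, fun b c hbc ↦ ?_⟩
  obtain ⟨⟨b', s⟩, hb⟩ := IsLocalization.surj M b
  obtain ⟨⟨c', s'⟩, hc⟩ := IsLocalization.surj M c
  simp only at hb hc
  have key : algebraMap A B ((b' * s' * s ^ 2 * s' ^ 2) ^ 2) =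
      algebraMap A B ((c' * s * s * s') ^ 3) := by
    simp only [map_pow, map_mul, ← hb, ← hc]
    linear_combination (algebraMap A B s) ^ 6 * (algebraMap A B s') ^ 6 * hbc
  obtain ⟨v, hv⟩ := (IsLocalization.eq_iff_exists M B).1 key
  have hv' : ((v : A) ^ 3 * (b' * s' * s ^ 2 * s' ^ 2)) ^ 2 =
      ((v : A) ^ 2 * (c' * s * s * s')) ^ 3 := by
    linear_combination (v : A) ^ 5 * hv
  obtain ⟨a, h2, h3⟩ := h.2 _ _ hv'
  have hu := IsLocalization.map_units B (v * s * s')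
  obtain ⟨w, hw⟩ := hu.exists_right_inv
  simp only [Submonoid.coe_mul, map_mul] at hw
  have h2' := congrArg (algebraMap A B) h2
  have h3' := congrArg (algebraMap A B) h3
  simp only [map_pow, map_mul, ← hb, ← hc] at h2' h3'
  set V := algebraMap A B v
  set S := algebraMap A B s
  set S' := algebraMap A B s'
  set α := algebraMap A B a
  refine ⟨α * w, ?_, ?_⟩
  · have : (V * S * S' * w) ^ 2 = 1 := by rw [hw, one_pow]
    linear_combination w ^ 2 * h2' + c * this
  · have : (V * S * S' * w) ^ 3 = 1 := by rw [hw, one_pow]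
    linear_combination w ^ 3 * h3' + b * this

theorem IsSwanSeminormal.isSwanSeminormalAt [Algebra A B] (P : Ideal A) [P.IsPrime]
    [IsLocalization.AtPrime B P] (h : IsSwanSeminormal B) : IsSwanSeminormalAt A P := by
  have hB := h.1
  refine ⟨fun z hz ↦ ?_, fun b c hbc ↦ ?_⟩
  · have : algebraMap A B z = algebraMap A B 0 := by
      rw [map_zero]
      exact eq_zero_of_sq_eq_zero (by rw [← map_pow, hz, map_zero])
    obtain ⟨s, hs⟩ := (IsLocalization.eq_iff_exists P.primeCompl B).1 this
    exact ⟨s, s.2, by simpa using hs⟩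
  · obtain ⟨a, h2, h3⟩ := h.2 (algebraMap A B b) (algebraMap A B c)
      (by rw [← map_pow, ← map_pow, hbc])
    obtain ⟨⟨a', s⟩, ha⟩ := IsLocalization.surj P.primeCompl a
    simp only at ha
    have k2 : algebraMap A B (a' ^ 2) = algebraMap A B (s ^ 2 * c) := by
      rw [map_pow, ← ha, map_mul, map_pow, ← h2]; ring
    have k3 : algebraMap A B (a' ^ 3) = algebraMap A B (s ^ 3 * b) := by
      rw [map_pow, ← ha, map_mul, map_pow, ← h3]; ring
    obtain ⟨v, hv⟩ := (IsLocalization.eq_iff_exists P.primeCompl B).1 k2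
    obtain ⟨w, hw⟩ := (IsLocalization.eq_iff_exists P.primeCompl B).1 k3
    refine ⟨v * w * s, (v * w * s).2, v * w * a', ?_, ?_⟩
    · linear_combination (v : A) * w ^ 2 * hv
    · linear_combination (v : A) ^ 3 * w ^ 2 * hw

/-- In a reduced Noetherian ring every element differs by an annihilating element from a
non-zero-divisor, up to a factor. -/
lemma exists_mul_add_mem_nonZeroDivisors [IsNoetherianRing A] [IsReduced A] (c : A) :
    ∃ u r : A, r * c = 0 ∧ u * c + r ∈ nonZeroDivisors A := by
  let N : Ideal A := LinearMap.ker (LinearMap.toSpanSingleton A A c)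
  let I : Ideal A := Ideal.span {c} ⊔ N
  have hI : FaithfulSMul A I := by
    rw [← Module.annihilator_eq_bot, eq_bot_iff]
    intro y hy
    rw [Submodule.mem_annihilator] at hy
    have h1 : y * c = 0 := hy c (Ideal.mem_sup_left (Ideal.mem_span_singleton_self c))
    have h2 : y * y = 0 := hy y (Ideal.mem_sup_right (by simpa [N] using h1))
    simpa using eq_zero_of_sq_eq_zero (by rw [sq, h2])
  obtain ⟨d, hd, hd'⟩ := Ideal.nonempty_inter_nonZeroDivisors_of_faithfulSMul (I := I)
  obtain ⟨y, hy, r, hr, rfl⟩ := Submodule.mem_sup.1 hd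
  obtain ⟨u, rfl⟩ := Ideal.mem_span_singleton'.1 hy
  exact ⟨u, r, by simpa [N] using hr, hd'⟩

lemma exists_fractionRing_sq_cube [IsNoetherianRing A] [IsReduced A] {b c : A}
    (hbc : b ^ 2 = c ^ 3) : ∃ x : FractionRing A,
      x ^ 2 = algebraMap A _ c ∧ x ^ 3 = algebraMap A _ b := by
  obtain ⟨u, r, hr, hd⟩ := exists_mul_add_mem_nonZeroDivisors c
  have hrb : r * b = 0 := eq_zero_of_sq_eq_zero (by linear_combination r ^ 2 * hbc + r * c ^ 2 * hr)
  have hunit := IsLocalization.map_units (FractionRing A) (⟨_, hd⟩ : nonZeroDivisors A)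
  obtain ⟨w, hw⟩ := hunit.exists_right_inv
  have e1 : u ^ 2 * b ^ 2 = (u * c + r) ^ 2 * c := by
    linear_combination u ^ 2 * hbc - (2 * u * c + r) * hr
  have e2 : u ^ 3 * b ^ 3 = (u * c + r) ^ 3 * b := by
    linear_combination u ^ 3 * b * hbc - (3 * u ^ 2 * c ^ 2 + 3 * u * c * r + r ^ 2) * hrb
  have f1 := congrArg (algebraMap A (FractionRing A)) e1
  have f2 := congrArg (algebraMap A (FractionRing A)) e2
  rw [map_mul _ (_ ^ 2), map_mul _ (_ ^ 2), map_pow _ (_ + _)] at f1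
  rw [map_mul _ (_ ^ 3), map_mul _ (_ ^ 3), map_pow _ (_ + _)] at f2
  simp only at hw
  refine ⟨algebraMap A _ u * algebraMap A _ b * w, ?_, ?_⟩
  · have := congrArg (· ^ 2) hw
    simp only [mul_pow, one_pow] at this
    rw [map_pow, map_pow] at f1
    linear_combination w ^ 2 * f1 + algebraMap A _ c * this
  · have := congrArg (· ^ 3) hw
    simp only [mul_pow, one_pow] at this
    rw [map_pow, map_pow] at f2
    linear_combination w ^ 3 * f2 + algebraMap A _ b * this

end Swan

section Length

variable {A : Type*} [CommRing A]

lemma length_quotient_eq_add {M : Type*} [AddCommGroup M] [Module A M] {P Q : Submodule A M}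
    (h : P ≤ Q) :
    Module.length A (M ⧸ P) =
      Module.length A (Q ⧸ P.comap Q.subtype) + Module.length A (M ⧸ Q) := by
  refine Module.length_eq_add_of_exact (Submodule.mapQ (P.comap Q.subtype) P Q.subtype le_rfl)
    (Submodule.factor h) ?_ (Submodule.factor_surjective h) ?_
  · rw [← LinearMap.ker_eq_bot, Submodule.ker_mapQ, Submodule.mkQ_map_self]
  · intro y
    obtain ⟨y, rfl⟩ := P.mkQ_surjective y
    constructor
    · intro hy
      have hy' : y ∈ Q := by simpa [Submodule.factor] using hy
      exact ⟨Submodule.Quotient.mk ⟨y, hy'⟩, rfl⟩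
    · rintro ⟨z, hz⟩
      obtain ⟨⟨z, hzQ⟩, rfl⟩ := Submodule.mkQ_surjective _ z
      rw [← hz]
      simpa [Submodule.factor] using hzQ

/-- The length of `N / t N` for a submodule `N`. -/
noncomputable def Submodule.smulLength {M : Type*} [AddCommGroup M] [Module A M] (t : A)
    (N : Submodule A M) : ℕ∞ :=
  Module.length A (N ⧸ (N.map (LinearMap.lsmul A M t)).comap N.subtype)

lemma length_map_lsmul_quotient {M : Type*} [AddCommGroup M] [Module A M] (t : A)
    (ht : Function.Injective (LinearMap.lsmul A M t)) {P Q : Submodule A M} (h : P ≤ Q) :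
    Module.length A (Q.map (LinearMap.lsmul A M t) ⧸
      (P.map (LinearMap.lsmul A M t)).comap (Q.map (LinearMap.lsmul A M t)).subtype) =
    Module.length A (Q ⧸ P.comap Q.subtype) := by
  let e := Submodule.equivMapOfInjective (LinearMap.lsmul A M t) ht Q
  refine (Submodule.Quotient.equiv _ _ e ?_).length_eq.symm
  ext ⟨y, hy⟩
  constructor
  · rintro ⟨z, hz, hz'⟩
    exact ⟨z, hz, congrArg Subtype.val hz'⟩
  · rintro ⟨z, hz, hz'⟩
    exact ⟨⟨z, h hz⟩, hz, Subtype.ext hz'⟩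

lemma Submodule.smulLength_eq {M : Type*} [AddCommGroup M] [Module A M] (t : A)
    (ht : Function.Injective (LinearMap.lsmul A M t)) {P Q : Submodule A M} (h : P ≤ Q)
    (hfin : Module.length A (Q ⧸ P.comap Q.subtype) ≠ ⊤) :
    P.smulLength t = Q.smulLength t := by
  have hP : P.map (LinearMap.lsmul A M t) ≤ P := by
    rintro _ ⟨z, hz, rfl⟩; exact P.smul_mem t hz
  have hQ : Q.map (LinearMap.lsmul A M t) ≤ Q := by
    rintro _ ⟨z, hz, rfl⟩; exact Q.smul_mem t hz
  have key : ∀ {X Y Z : Submodule A M}, X ≤ Y → Y ≤ Z →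
      Module.length A (Z ⧸ X.comap Z.subtype) =
        Module.length A (Y ⧸ X.comap Y.subtype) + Module.length A (Z ⧸ Y.comap Z.subtype) := by
    intro X Y Z hXY hYZ
    rw [length_quotient_eq_add (P := X.comap Z.subtype) (Q := Y.comap Z.subtype)
      (Submodule.comap_mono hXY)]
    congr 1
    refine (Submodule.Quotient.equiv _ _ (Submodule.comapSubtypeEquivOfLe hYZ) ?_).length_eq
    ext ⟨y, hy⟩
    constructor
    · rintro ⟨z, hz, hz'⟩
      have : (z : M) = y := congrArg Subtype.val hz'
      exact this ▸ hz
    · intro hyX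
      exact ⟨⟨⟨y, hYZ hy⟩, hy⟩, hyX, rfl⟩
  have h1 := key hP h
  have h2 := key (Submodule.map_mono h) hQ
  rw [length_map_lsmul_quotient t ht h] at h2
  rw [h2, add_comm] at h1
  exact (ENat.add_left_injective_of_ne_top hfin h1).symm

lemma length_quotient_comap_map_range {M F : Type*} [AddCommGroup M] [Module A M]
    [AddCommGroup F] [Module A F] (t : A) (φ : F →ₗ[A] M) :
    Module.length A (F ⧸ ((LinearMap.range φ).map (LinearMap.lsmul A M t)).comap φ) =
      (LinearMap.range φ).smulLength t := by
  let ψ := (((LinearMap.range φ).map (LinearMap.lsmul A M t)).comap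
    (LinearMap.range φ).subtype).mkQ ∘ₗ φ.rangeRestrict
  have hψ : Function.Surjective ψ :=
    (Submodule.mkQ_surjective _).comp φ.surjective_rangeRestrict
  have hker : LinearMap.ker ψ =
      ((LinearMap.range φ).map (LinearMap.lsmul A M t)).comap φ := by
    ext f
    simp [ψ]
  rw [← hker]
  exact (ψ.quotKerEquivOfSurjective hψ).length_eq

lemma length_quotient_le {M : Type*} [AddCommGroup M] [Module A M] {P Q : Submodule A M}
    (h : P ≤ Q) : Module.length A (M ⧸ Q) ≤ Module.length A (M ⧸ P) :=
  Module.length_le_of_surjective _ (Submodule.factor_surjective h)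

lemma length_quotient_lt {M : Type*} [AddCommGroup M] [Module A M] {P Q : Submodule A M}
    (h : P < Q) (hP : Module.length A (M ⧸ P) ≠ ⊤) :
    Module.length A (M ⧸ Q) < Module.length A (M ⧸ P) := by
  rw [length_quotient_eq_add h.le] at hP ⊢
  refine lt_of_lt_of_le (ENat.lt_add_left (fun hh ↦ hP (by rw [hh, add_top])) ?_) le_rfl
  rw [Module.length_pos_iff, Submodule.Quotient.nontrivial_iff]
  intro htop
  obtain ⟨y, hyQ, hyP⟩ := SetLike.exists_of_lt h
  have : (⟨y, hyQ⟩ : Q) ∈ P.comap Q.subtype := htop ▸ Submodule.mem_top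
  exact hyP this

end Length

section DimensionOne

variable {O : Type*} [CommRing O] [IsDomain O] [IsNoetherianRing O]

lemma krullDimLE_one_of_mem_minimalPrimes [IsLocalRing O] (τ : O)
    (h : IsLocalRing.maximalIdeal O ∈ (Ideal.span {τ}).minimalPrimes) : Ring.KrullDimLE 1 O := by
  have h1 := Ideal.height_le_one_of_isPrincipal_of_mem_minimalPrimes (Ideal.span {τ}) _ h
  have : Ring.DimensionLEOne O := by
    refine ⟨fun {P} hP0 hP ↦ ?_⟩
    have hle := IsLocalRing.le_maximalIdeal hP.ne_top
    rcases hle.eq_or_lt with rfl | hlt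
    · infer_instance
    · have h2 := Ideal.height_add_one_le_of_lt_of_isPrime (bot_lt_iff_ne_bot.2 hP0)
      have h3 := Ideal.height_add_one_le_of_lt_of_isPrime hlt
      have h4 : (1 : ℕ∞) ≤ P.height := le_trans le_add_self h2
      have h5 : (2 : ℕ∞) ≤ 1 := by
        calc (2 : ℕ∞) = 1 + 1 := by norm_num
          _ ≤ P.height + 1 := by gcongr
          _ ≤ _ := h3
          _ ≤ 1 := h1
      exact absurd h5 (by norm_num)
  infer_instance

lemma smulLength_eq_top_smulLength {A : Type*} [CommRing A] [Algebra A O]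
    (hA : Function.Surjective (algebraMap A O)) [Ring.KrullDimLE 1 O] (t : A)
    (ht : algebraMap A O t ≠ 0) {X : Submodule A O} (hX : X ≠ ⊥) :
    X.smulLength t = Module.length A (O ⧸ (⊤ : Submodule A O).map (LinearMap.lsmul A O t)) ∧
      X.smulLength t ≠ ⊤ := by
  have htinj : Function.Injective (LinearMap.lsmul A O t) := by
    intro y z hyz
    simp only [LinearMap.lsmul_apply, Algebra.smul_def] at hyz
    exact mul_left_cancel₀ ht hyz
  have hfin : ∀ Y : Submodule A O, Y ≠ ⊥ → Module.length A (O ⧸ Y) ≠ ⊤ := by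
    intro Y hY
    obtain ⟨y, hy, hy0⟩ := Y.exists_mem_ne_zero_of_ne_bot hY
    have h1 : IsFiniteLength O (O ⧸ Ideal.span {y}) :=
      isFiniteLength_quotient_span_singleton O (mem_nonZeroDivisors_of_ne_zero hy0)
    have h2 := Module.length_ne_top_iff.2 h1
    rw [← Module.length_eq_of_surjective hA] at h2
    have hle : (Ideal.span {y}).restrictScalars A ≤ Y := by
      intro z hz
      obtain ⟨a, rfl⟩ := Ideal.mem_span_singleton'.1 hz
      obtain ⟨a, rfl⟩ := hA a
      rw [← Algebra.smul_def]
      exact Y.smul_mem _ hy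
    refine ne_top_of_le_ne_top h2 ((length_quotient_le hle).trans ?_)
    exact (Submodule.Quotient.restrictScalarsEquiv A (Ideal.span {y})).length_eq.le
  have hquot : ∀ P : Submodule A O,
      Module.length A ((⊤ : Submodule A O) ⧸ P.comap (Submodule.subtype ⊤)) =
      Module.length A (O ⧸ P) := by
    intro P
    refine (Submodule.Quotient.equiv _ _ (Submodule.topEquiv) ?_).length_eq
    ext y
    constructor
    · rintro ⟨z, hz, rfl⟩; exact hz
    · intro hy; exact ⟨⟨y, trivial⟩, hy, rfl⟩
  have h1 := Submodule.smulLength_eq t htinj (le_top (a := X)) (by rw [hquot]; exact hfin X hX)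
  rw [h1, Submodule.smulLength, hquot]
  refine ⟨rfl, hfin _ fun h ↦ ht ?_⟩
  have : algebraMap A O t ∈ (⊤ : Submodule A O).map (LinearMap.lsmul A O t) :=
    ⟨1, trivial, by simp [Algebra.smul_def]⟩
  rwa [h] at this

end DimensionOne

section Conductor

variable {A F : Type*} [CommRing A] [CommRing F]

lemma IsSwanSeminormal.mem_range (hA : IsSwanSeminormal A) [IsReduced F] (i : A →+* F)
    (hi : Function.Injective i) {g : F} (h2 : g ^ 2 ∈ i.range) (h3 : g ^ 3 ∈ i.range) :
    g ∈ i.range := by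
  obtain ⟨c, hc⟩ := h2
  obtain ⟨b, hb⟩ := h3
  obtain ⟨a, ha2, ha3⟩ := hA.2 b c (hi (by rw [map_pow, map_pow, hb, hc]; ring))
  exact ⟨a, eq_of_sq_eq_of_cube_eq (by rw [← hc, ← ha2, map_pow]) (by rw [← hb, ← ha3, map_pow])⟩

lemma IsSwanSeminormal.mem_range_of_pow (hA : IsSwanSeminormal A) [IsReduced F] (i : A →+* F)
    (hi : Function.Injective i) {g : F} (k : ℕ) (h : ∀ m, k ≤ m → g ^ m ∈ i.range) :
    g ∈ i.range := by
  induction k with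
  | zero => simpa using h 1 (by omega)
  | succ k ih =>
    rcases Nat.eq_zero_or_pos k with rfl | hk
    · simpa using h 1 le_rfl
    · refine ih fun m hm ↦ ?_
      rcases hm.eq_or_lt with rfl | hm
      · apply hA.mem_range i hi
        · rw [← pow_mul]; exact h _ (by omega)
        · rw [← pow_mul]; exact h _ (by omega)
      · exact h m hm

/-- The ideal of all `a` with `a • y` in the image of `A`. -/
def denominatorIdeal (A : Type*) {Q : Type*} [CommRing A] [CommRing Q] [Algebra A Q] (y : Q) :
    Ideal A :=
  (LinearMap.range (Algebra.linearMap A Q)).comap (LinearMap.toSpanSingleton A Q y)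

lemma mem_denominatorIdeal [Algebra A F] {y : F} {h : A} :
    h ∈ denominatorIdeal A y ↔ ∃ a, algebraMap A F a = h • y := by
  simp [denominatorIdeal]

variable [Algebra A F]

lemma IsSwanSeminormal.mem_range_add_of_mem_radical [Module.Finite A F] {t : A} {n : Ideal A}
    (hS : IsSwanSeminormal (A ⧸ Ideal.span {t}))
    (hA : ∀ a : A, algebraMap A F a ∈ Ideal.span {algebraMap A F t} → a ∈ Ideal.span {t})
    (hF : ∀ f : F, f ^ 2 ∈ Ideal.span {algebraMap A F t} → f ∈ Ideal.span {algebraMap A F t})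
    (hden : ∀ f : F, n ≤ (denominatorIdeal A f ⊔ Ideal.span {t}).radical)
    {g : F} (hg : g ∈ (n.map (algebraMap A F)).radical) :
    ∃ a f, g = algebraMap A F a + algebraMap A F t * f := by
  let W : Submodule A F := LinearMap.range (Algebra.linearMap A F) ⊔
    (Ideal.span {algebraMap A F t}).restrictScalars A
  have hW : ∀ w, w ∈ W ↔ ∃ a f, w = algebraMap A F a + algebraMap A F t * f := by
    intro w
    simp only [W, Submodule.mem_sup, LinearMap.mem_range, Submodule.restrictScalars_mem,
      Ideal.mem_span_singleton', Algebra.linearMap_apply]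
    constructor
    · rintro ⟨_, ⟨a, rfl⟩, _, ⟨f, rfl⟩, rfl⟩
      exact ⟨a, f, by ring⟩
    · rintro ⟨a, f, rfl⟩
      exact ⟨_, ⟨a, rfl⟩, _, ⟨f, rfl⟩, by ring⟩
  let 𝔠 : Ideal A := W.colon ((⊤ : Submodule A F) : Set F)
  have hn : ∀ N : Submodule A F, N.FG → n ≤ (W.colon (N : Set F)).radical := by
    intro N hN
    induction N, hN using Submodule.fg_induction with
    | singleton f =>
      refine (hden f).trans (Ideal.radical_mono (sup_le ?_ ?_))
      · intro h hh
        obtain ⟨a, ha⟩ := mem_denominatorIdeal.1 hh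
        rw [Submodule.mem_colon]
        intro y hy
        obtain ⟨s, rfl⟩ := Submodule.mem_span_singleton.1 hy
        rw [smul_comm, ← ha]
        exact W.smul_mem _ ((hW _).2 ⟨a, 0, by ring⟩)
      · rw [Ideal.span_singleton_le_iff_mem, Submodule.mem_colon]
        intro y _
        exact (hW _).2 ⟨0, y, by rw [map_zero, zero_add, Algebra.smul_def]⟩
    | sup N N' _ _ hN hN' =>
      have : W.colon (N : Set F) ⊓ W.colon (N' : Set F) ≤
          W.colon ((N ⊔ N' : Submodule A F) : Set F) := by
        rintro h ⟨h1, h2⟩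
        simp only [SetLike.mem_coe, Submodule.mem_colon] at h1 h2 ⊢
        intro y hy
        obtain ⟨z, hz, z', hz', rfl⟩ := Submodule.mem_sup.1 hy
        rw [smul_add]
        exact W.add_mem (h1 z hz) (h2 z' hz')
      refine le_trans ?_ (Ideal.radical_mono this)
      rw [Ideal.radical_inf]
      exact le_inf hN hN'
  have hn𝔠 : n ≤ 𝔠.radical := hn ⊤ Module.Finite.fg_top
  have h𝔠 : ∀ y ∈ 𝔠.map (algebraMap A F), y ∈ W := by
    have : ∀ y ∈ 𝔠.map (algebraMap A F), ∀ f, y * f ∈ W := by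
      intro y hy
      induction hy using Submodule.span_induction with
      | mem y hy =>
        obtain ⟨h, hh, rfl⟩ := hy
        intro f
        rw [← Algebra.smul_def]
        exact Submodule.mem_colon.1 hh f trivial
      | zero => intro f; rw [zero_mul]; exact W.zero_mem
      | add y z _ _ hy hz => intro f; rw [add_mul]; exact W.add_mem (hy f) (hz f)
      | smul r y _ hy => intro f; rw [smul_eq_mul, mul_comm r, mul_assoc]; exact hy _
    intro y hy
    simpa using this y hy 1
  have hg' : g ∈ (𝔠.map (algebraMap A F)).radical := by
    have h1 : n.map (algebraMap A F) ≤ (𝔠.map (algebraMap A F)).radical :=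
      (Ideal.map_mono hn𝔠).trans (Ideal.map_radical_le _)
    have h2 := Ideal.radical_mono h1 hg
    rwa [Ideal.radical_idem] at h2
  obtain ⟨k, hk⟩ := hg'
  let G := F ⧸ Ideal.span {algebraMap A F t}
  have hle : Ideal.span {t} ≤ (Ideal.span {algebraMap A F t}).comap (algebraMap A F) := by
    rw [Ideal.span_singleton_le_iff_mem]
    exact Ideal.mem_span_singleton_self _
  let i : A ⧸ Ideal.span {t} →+* G := Ideal.quotientMap _ (algebraMap A F) hle
  have hi : Function.Injective i := Ideal.quotientMap_injective' fun a ha ↦ hA a ha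
  have hG : IsReduced G := by
    refine IsReduced.of_sq_eq_zero fun z hz ↦ ?_
    obtain ⟨z, rfl⟩ := Ideal.Quotient.mk_surjective z
    rw [← map_pow, Ideal.Quotient.eq_zero_iff_mem] at hz
    exact Ideal.Quotient.eq_zero_iff_mem.2 (hF z hz)
  have hmem : Ideal.Quotient.mk _ g ∈ i.range := by
    refine hS.mem_range_of_pow i hi k fun m hm ↦ ?_
    obtain ⟨a, f, haf⟩ := (hW _).1 (h𝔠 _ (Ideal.mem_of_dvd _ (pow_dvd_pow g hm) hk))
    refine ⟨Ideal.Quotient.mk _ a, ?_⟩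
    rw [← map_pow, haf, Ideal.quotientMap_mk, eq_comm, Ideal.Quotient.eq, add_sub_cancel_left]
    exact Ideal.mul_mem_right _ _ (Ideal.mem_span_singleton_self _)
  obtain ⟨a, ha⟩ := hmem
  obtain ⟨a, rfl⟩ := Ideal.Quotient.mk_surjective a
  rw [Ideal.quotientMap_mk, eq_comm, Ideal.Quotient.eq, Ideal.mem_span_singleton'] at ha
  obtain ⟨f, hf⟩ := ha
  exact ⟨a, f, by rw [mul_comm, hf]; ring⟩

end Conductor

section LengthComparison

variable {A F : Type*} [CommRing A] [CommRing F] [Algebra A F] [IsNoetherianRing A]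
  [IsLocalRing A] [Module.Finite A F]

open IsLocalRing in
/-- A comparison of lengths: there is no derivation `β` with properties as below. -/
lemma false_of_derivation_of_radical {t : A} {N : ℕ} (q : Ideal A) [q.IsPrime] (htq : t ∉ q)
    (htn : t ∈ maximalIdeal A)
    (hn : maximalIdeal A ≤ (q ⊔ Ideal.span {t}).radical)
    (hrad : ∀ g ∈ ((maximalIdeal A).map (algebraMap A F)).radical,
      ∃ a f, g = algebraMap A F a + algebraMap A F t * f)
    (α β : F →ₗ[A] A ⧸ q) (hα1 : α 1 = algebraMap A (A ⧸ q) (t ^ N)) (hβ1 : β 1 = 0)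
    (hα : ∀ f g, algebraMap A (A ⧸ q) (t ^ N) * α (f * g) = α f * α g)
    (hβ : ∀ f g, algebraMap A (A ⧸ q) (t ^ N) * β (f * g) = α f * β g + α g * β f)
    (hβ0 : β ≠ 0) : False := by
  have hτ : algebraMap A (A ⧸ q) t ≠ 0 := by
    rwa [Ideal.Quotient.algebraMap_eq, Ne, Ideal.Quotient.eq_zero_iff_mem]
  have hτN : algebraMap A (A ⧸ q) (t ^ N) ≠ 0 := by rw [map_pow]; exact pow_ne_zero _ hτ
  have hsurj : Function.Surjective (algebraMap A (A ⧸ q)) := Ideal.Quotient.mk_surjective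
  have : IsLocalRing (A ⧸ q) := .of_surjective' _ hsurj
  have hloc : IsLocalHom (algebraMap A (A ⧸ q)) := IsLocalHom.of_surjective _ hsurj
  have hmin : maximalIdeal (A ⧸ q) ∈ (Ideal.span {algebraMap A (A ⧸ q) t}).minimalPrimes := by
    refine ⟨⟨inferInstance, ?_⟩, fun P ⟨hP, hPt⟩ _ ↦ ?_⟩
    · rw [Ideal.span_singleton_le_iff_mem]
      exact map_nonunit (algebraMap A (A ⧸ q)) t htn
    · have h1 : maximalIdeal A ≤ P.comap (algebraMap A (A ⧸ q)) := by
        refine hn.trans ((hP.comap _).radical_le_iff.2 (sup_le ?_ ?_))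
        · intro a ha
          rw [Ideal.mem_comap, Ideal.Quotient.algebraMap_eq, Ideal.Quotient.eq_zero_iff_mem.2 ha]
          exact P.zero_mem
        · rw [Ideal.span_singleton_le_iff_mem] at hPt ⊢
          exact hPt
      intro y hy
      obtain ⟨a, rfl⟩ := hsurj y
      exact h1 fun hu ↦ hy (hu.map _)
  have := krullDimLE_one_of_mem_minimalPrimes _ hmin
  have hα0 : LinearMap.range α ≠ ⊥ := by
    intro h
    exact hτN (by rw [← hα1]; simp [LinearMap.range_eq_bot.1 h])
  have hX := smulLength_eq_top_smulLength hsurj t hτ hα0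
  have hN := smulLength_eq_top_smulLength hsurj t hτ (mt LinearMap.range_eq_bot.1 hβ0)
  rw [← length_quotient_comap_map_range] at hX hN
  set KX := ((LinearMap.range α).map (LinearMap.lsmul A (A ⧸ q) t)).comap α with hKX
  set KN := ((LinearMap.range β).map (LinearMap.lsmul A (A ⧸ q) t)).comap β with hKN
  let K := LinearMap.ker α ⊔ ((maximalIdeal A).map (algebraMap A F)).restrictScalars A
  have hKXK : KX ≤ K := by
    rintro g ⟨_, ⟨f, rfl⟩, hf⟩
    rw [LinearMap.lsmul_apply] at hf
    have : g = (g - t • f) + t • f := by ring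
    rw [this]
    refine Submodule.add_mem_sup ?_ ?_
    · rw [LinearMap.mem_ker, map_sub, map_smul, hf, sub_self]
    · rw [Submodule.restrictScalars_mem, Algebra.smul_def]
      exact Ideal.mul_mem_right _ _ (Ideal.mem_map_of_mem _ htn)
  have hβA : ∀ a, β (algebraMap A F a) = 0 := fun a ↦ by
    rw [Algebra.algebraMap_eq_smul_one, map_smul, hβ1, smul_zero]
  have hradKN : ∀ g ∈ ((maximalIdeal A).map (algebraMap A F)).radical, g ∈ KN := by
    intro g hg
    obtain ⟨a, f, rfl⟩ := hrad g hg
    refine ⟨β f, ⟨f, rfl⟩, ?_⟩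
    rw [map_add, hβA, zero_add, ← Algebra.smul_def, map_smul, LinearMap.lsmul_apply]
  have hkerKN : ∀ g, α g = 0 → g ∈ KN := by
    intro g hg
    let 𝔪 := (maximalIdeal A).map (algebraMap A F)
    let : Field (A ⧸ maximalIdeal A) := Ideal.Quotient.field _
    have : Module.Finite (A ⧸ maximalIdeal A) (F ⧸ 𝔪) :=
      Module.Finite.of_restrictScalars_finite A _ _
    have : IsArtinianRing (F ⧸ 𝔪) := IsArtinianRing.of_finite (A ⧸ maximalIdeal A) _
    obtain ⟨k, y, hy⟩ := IsArtinian.exists_pow_succ_smul_dvd (Ideal.Quotient.mk 𝔪 g) (1 : F ⧸ 𝔪)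
    obtain ⟨y, rfl⟩ := Ideal.Quotient.mk_surjective y
    have hmem : g ^ k * (1 - g * y) ∈ 𝔪 := by
      rw [← Ideal.Quotient.eq_zero_iff_mem]
      simp only [smul_eq_mul, mul_one, Nat.succ_eq_add_one, pow_succ] at hy
      rw [map_mul, map_pow, map_sub, map_mul, map_one]
      linear_combination -hy
    have h1 : g * (1 - g * y) ∈ 𝔪.radical :=
      ⟨k + 1, by
        have : (g * (1 - g * y)) ^ (k + 1) = g ^ k * (1 - g * y) * (g * (1 - g * y) ^ k) := by
          rw [mul_pow, pow_succ, pow_succ]; ring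
        rw [this]; exact Ideal.mul_mem_right _ _ hmem⟩
    have h2 : α (g * y) = 0 := by
      have := hα g y
      rw [hg, zero_mul] at this
      exact (mul_eq_zero.1 this).resolve_left hτN
    have h3 : β (g * (g * y)) = 0 := by
      have := hβ g (g * y)
      rw [hg, h2, zero_mul, zero_mul, add_zero] at this
      exact (mul_eq_zero.1 this).resolve_left hτN
    have : g = g * (g * y) + g * (1 - g * y) := by ring
    rw [this]
    refine KN.add_mem ?_ (hradKN _ h1)
    rw [hKN, Submodule.mem_comap, h3]; exact Submodule.zero_mem _
  have hKKN : K ≤ KN := by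
    refine sup_le (fun g hg ↦ hkerKN g hg) fun g hg ↦ hradKN g (Ideal.le_radical hg)
  have h1 : (1 : F) ∈ KN := by
    rw [hKN, Submodule.mem_comap, hβ1]; exact Submodule.zero_mem _
  have h1K : (1 : F) ∉ K := by
    intro h
    obtain ⟨a, ha, ν, hν, haν⟩ := Submodule.mem_sup.1 h
    have hker : ∀ f, α (f * a) = 0 := fun f ↦ by
      have := hα f a
      rw [LinearMap.mem_ker.1 ha, mul_zero] at this
      exact (mul_eq_zero.1 this).resolve_left hτN
    apply hα0
    refine Submodule.eq_bot_of_le_smul_of_le_jacobson_bot (maximalIdeal A) _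
      (by rw [LinearMap.range_eq_map]; exact Module.Finite.fg_top.map _) ?_
      (IsLocalRing.maximalIdeal_le_jacobson _)
    rintro _ ⟨f, rfl⟩
    have h2 : α f = α (f * ν) := by
      conv_lhs => rw [← mul_one f, ← haν, mul_add, map_add, hker, zero_add]
    rw [h2, LinearMap.range_eq_map, ← Submodule.map_smul'']
    refine Submodule.mem_map_of_mem ?_
    rw [Ideal.smul_top_eq_map]
    exact Ideal.mul_mem_left _ _ hν
  have hlt : K < KN := lt_of_le_of_ne hKKN fun h ↦ h1K (h ▸ h1)
  have hle := length_quotient_le hKXK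
  have hlt' := length_quotient_lt hlt (ne_top_of_le_ne_top hX.2 hle)
  rw [hN.1] at hlt'
  rw [hX.1] at hle
  exact absurd hlt' (not_lt.2 hle)

end LengthComparison

section Denominators

variable {A Q : Type*} [CommRing A] [CommRing Q] [Algebra A Q]

lemma denominatorIdeal_eq_top_iff {y : Q} :
    denominatorIdeal A y = ⊤ ↔ y ∈ (algebraMap A Q).range := by
  rw [Ideal.eq_top_iff_one, mem_denominatorIdeal, one_smul]; rfl

lemma denominatorIdeal_le_smul (s : A) (y : Q) :
    denominatorIdeal A y ≤ denominatorIdeal A (s • y) := by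
  intro h hh
  obtain ⟨a, ha⟩ := mem_denominatorIdeal.1 hh
  exact mem_denominatorIdeal.2 ⟨s * a, by rw [smul_comm, ← ha, map_mul, Algebra.smul_def]⟩

lemma denominatorIdeal_mul_le_mul (y y' : Q) :
    denominatorIdeal A y * denominatorIdeal A y' ≤ denominatorIdeal A (y * y') := by
  rw [Ideal.mul_le]
  intro h hh h' hh'
  obtain ⟨a, ha⟩ := mem_denominatorIdeal.1 hh
  obtain ⟨a', ha'⟩ := mem_denominatorIdeal.1 hh'
  exact mem_denominatorIdeal.2 ⟨a * a', by rw [map_mul, ha, ha', smul_mul_smul_comm]⟩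

lemma denominatorIdeal_mul_le_add (y y' : Q) :
    denominatorIdeal A y * denominatorIdeal A y' ≤ denominatorIdeal A (y + y') := by
  refine Ideal.mul_le_inf.trans ?_
  rintro h ⟨hh, hh'⟩
  obtain ⟨a, ha⟩ := mem_denominatorIdeal.1 hh
  obtain ⟨a', ha'⟩ := mem_denominatorIdeal.1 hh'
  exact mem_denominatorIdeal.2 ⟨a + a', by rw [map_add, ha, ha', smul_add]⟩

lemma le_radical_sup_of_mul_le {n I J K T : Ideal A} (hI : n ≤ (I ⊔ T).radical)
    (hJ : n ≤ (J ⊔ T).radical) (h : I * J ≤ K) : n ≤ (K ⊔ T).radical := by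
  have h1 : (I ⊔ T) * (J ⊔ T) ≤ K ⊔ T := by
    rw [Ideal.mul_le]
    intro y hy z hz
    obtain ⟨i, hi, τ, hτ, rfl⟩ := Submodule.mem_sup.1 hy
    obtain ⟨j, hj, τ', hτ', rfl⟩ := Submodule.mem_sup.1 hz
    have : (i + τ) * (j + τ') = i * j + ((j + τ') * τ + i * τ') := by ring
    rw [this]
    exact Submodule.add_mem_sup (h (Ideal.mul_mem_mul hi hj))
      (T.add_mem (T.mul_mem_left _ hτ) (T.mul_mem_left _ hτ'))
  refine le_trans ?_ (Ideal.radical_mono h1)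
  rw [Ideal.radical_mul]
  exact le_inf hI hJ

lemma exists_denominatorIdeal_smul_isPrime [IsNoetherianRing A] {y : Q}
    (hy : denominatorIdeal A y ≠ ⊤) : ∃ s : A, (denominatorIdeal A (s • y)).IsPrime := by
  have h1 : (Ideal.Quotient.mk (denominatorIdeal A y) 1 : A ⧸ denominatorIdeal A y) ≠ 0 := by
    rwa [Ne, Ideal.Quotient.eq_zero_iff_mem, ← Ideal.eq_top_iff_one]
  obtain ⟨P, hP, -⟩ := exists_le_isAssociatedPrime_of_isNoetherianRing A _ h1
  obtain ⟨hP, m, rfl⟩ := (isAssociatedPrime_iff).1 hP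
  obtain ⟨s, rfl⟩ := Ideal.Quotient.mk_surjective m
  refine ⟨s, ?_⟩
  convert hP
  ext h
  rw [Submodule.mem_colon_singleton, Submodule.mem_bot, mem_denominatorIdeal, smul_smul,
    ← mem_denominatorIdeal, ← Ideal.Quotient.eq_zero_iff_mem]
  rfl

open IsLocalRing

/-- Elements defined outside the closed point of the divisor `t = 0`, and away from it, are
regular. -/
lemma denominatorIdeal_eq_top_of_le_radical [IsNoetherianRing A] [IsLocalRing A]
    (hinj : Function.Injective (algebraMap A Q)) {t : A} (htu : IsUnit (algebraMap A Q t))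
    (htn : t ∈ maximalIdeal A)
    (hnt : ¬ maximalIdeal A ≤ Ideal.span {t})
    (hred : ∀ z : A, z ^ 2 ∈ Ideal.span {t} → z ∈ Ideal.span {t})
    {y : Q} {N : ℕ} (hN : t ^ N ∈ denominatorIdeal A y)
    (hy : maximalIdeal A ≤ (denominatorIdeal A y ⊔ Ideal.span {t}).radical) :
    denominatorIdeal A y = ⊤ := by
  by_contra hne
  obtain ⟨s, hs⟩ := exists_denominatorIdeal_smul_isPrime hne
  have hle := denominatorIdeal_le_smul (A := A) s y
  have hn : denominatorIdeal A (s • y) = maximalIdeal A := by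
    refine le_antisymm (le_maximalIdeal hs.ne_top) (hy.trans (hs.radical_le_iff.2
      (sup_le hle ?_)))
    rw [Ideal.span_singleton_le_iff_mem]
    exact hs.mem_of_pow_mem N (hle hN)
  obtain ⟨z, hz⟩ := mem_denominatorIdeal.1 (hn ▸ htn)
  have hzt : z ∉ Ideal.span {t} := by
    intro h
    obtain ⟨w, rfl⟩ := Ideal.mem_span_singleton'.1 h
    apply hs.ne_top
    rw [denominatorIdeal_eq_top_iff]
    refine ⟨w, htu.mul_left_cancel ?_⟩
    rw [← Algebra.smul_def t (s • y), ← hz, map_mul, mul_comm]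
  have hzn : ∀ h ∈ maximalIdeal A, h * z ∈ Ideal.span {t} := by
    intro h hh
    rw [← hn] at hh
    obtain ⟨a, ha⟩ := mem_denominatorIdeal.1 hh
    rw [Ideal.mem_span_singleton']
    refine ⟨a, hinj ?_⟩
    rw [map_mul, map_mul, ha, hz, Algebra.smul_def h, Algebra.smul_def t]
    ring
  by_cases hzu : z ∈ maximalIdeal A
  · exact hzt (hred z (by rw [sq]; exact hzn z hzu))
  · apply hnt
    intro h hh
    have hu : IsUnit z := by simpa using hzu
    exact (Ideal.mul_unit_mem_iff_mem _ hu).1 (hzn h hh)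

lemma denominatorIdeal_eq_top_of_maximalIdeal_le [IsNoetherianRing A] [IsLocalRing A]
    (hinj : Function.Injective (algebraMap A Q)) {t : A} (htu : IsUnit (algebraMap A Q t))
    (htn : t ∈ maximalIdeal A) (hnt : maximalIdeal A ≤ Ideal.span {t})
    {x : Q} {c d : A} (hx : x ^ 2 = algebraMap A Q c) (hd0 : d ≠ 0)
    (hd : d ∈ denominatorIdeal A x) : denominatorIdeal A x = ⊤ := by
  have hn : maximalIdeal A = Ideal.span {t} :=
    le_antisymm hnt ((Ideal.span_singleton_le_iff_mem _).2 htn)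
  have hex : ∃ m, t ^ m ∈ denominatorIdeal A x := by
    have h1 := Ideal.iInf_pow_eq_bot_of_isLocalRing (maximalIdeal A)
      (maximalIdeal.isMaximal A).ne_top
    have h2 : ∃ m, d ∉ maximalIdeal A ^ m := by
      by_contra! h
      exact hd0 (by simpa [h1] using (Ideal.mem_iInf.2 h : d ∈ ⨅ i, maximalIdeal A ^ i))
    classical
    obtain ⟨m, hm, hmin⟩ : ∃ m, d ∉ maximalIdeal A ^ m ∧ ∀ k < m, d ∈ maximalIdeal A ^ k :=
      ⟨Nat.find h2, Nat.find_spec h2, fun k hk ↦ not_not.1 (Nat.find_min h2 hk)⟩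
    obtain _ | m := m
    · simp at hm
    have h3 := hmin m (by omega)
    rw [hn, Ideal.span_singleton_pow, Ideal.mem_span_singleton'] at h3 hm
    obtain ⟨w, rfl⟩ := h3
    have hw : IsUnit w := by
      by_contra hw
      have : w ∈ Ideal.span {t} := hnt ((mem_maximalIdeal _).2 hw)
      obtain ⟨w', rfl⟩ := Ideal.mem_span_singleton'.1 this
      exact hm ⟨w', by ring⟩
    exact ⟨m, (Ideal.unit_mul_mem_iff_mem _ hw).1 hd⟩
  classical
  obtain ⟨m, hm, hmin⟩ : ∃ m, t ^ m ∈ denominatorIdeal A x ∧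
      ∀ k < m, t ^ k ∉ denominatorIdeal A x :=
    ⟨Nat.find hex, Nat.find_spec hex, fun k hk ↦ Nat.find_min hex hk⟩
  obtain _ | m := m
  · rw [Ideal.eq_top_iff_one]; simpa using hm
  exfalso
  obtain ⟨r, hr⟩ := mem_denominatorIdeal.1 hm
  have hru : r ∉ Ideal.span {t} := by
    intro h
    obtain ⟨w, rfl⟩ := Ideal.mem_span_singleton'.1 h
    refine hmin m (by omega) (mem_denominatorIdeal.2 ⟨w, htu.mul_left_cancel ?_⟩)
    rw [← Algebra.smul_def t (t ^ m • x), smul_smul, ← pow_succ', ← hr, map_mul, mul_comm]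
  rw [← hn, mem_maximalIdeal, mem_nonunits_iff, not_not] at hru
  have h2 : r ^ 2 = t ^ (2 * (m + 1)) * c := by
    apply hinj
    rw [map_pow, hr, Algebra.smul_def, mul_pow, hx, map_mul, map_pow, map_pow, ← pow_mul,
      mul_comm 2]
  have h3 : IsUnit (t * (t ^ (2 * m + 1) * c)) := by
    have : t * (t ^ (2 * m + 1) * c) = r ^ 2 := by rw [h2]; ring
    rw [this]; exact hru.pow 2
  exact htn (isUnit_of_mul_isUnit_left h3)

/-- The elements of `A[x][1/t]` (where `x ^ 2 = c`) that are regular along the punctured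
divisor `t = 0`. -/
def cuspSaturation {t c : A} {x : Q} (hx : x ^ 2 = algebraMap A Q c) (n : Ideal A) :
    Subalgebra A Q where
  carrier := {y | (∃ (N : ℕ) (a b : A), t ^ N • y = algebraMap A Q a + b • x) ∧
    n ≤ (denominatorIdeal A y ⊔ Ideal.span {t}).radical}
  mul_mem' := by
    rintro y y' ⟨⟨N, a, b, h⟩, hn⟩ ⟨⟨N', a', b', h'⟩, hn'⟩
    refine ⟨⟨N + N', a * a' + b * b' * c, a * b' + b * a', ?_⟩,
      le_radical_sup_of_mul_le hn hn' (denominatorIdeal_mul_le_mul y y')⟩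
    rw [pow_add, ← smul_mul_smul_comm, h, h']
    simp only [Algebra.smul_def, map_add, map_mul]
    linear_combination algebraMap A Q b * algebraMap A Q b' * hx
  add_mem' := by
    rintro y y' ⟨⟨N, a, b, h⟩, hn⟩ ⟨⟨N', a', b', h'⟩, hn'⟩
    refine ⟨⟨N + N', t ^ N' * a + t ^ N * a', t ^ N' * b + t ^ N * b', ?_⟩,
      le_radical_sup_of_mul_le hn hn' (denominatorIdeal_mul_le_add y y')⟩
    have : t ^ (N + N') • (y + y') = t ^ N' • t ^ N • y + t ^ N • t ^ N' • y' := by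
      simp only [Algebra.smul_def, map_pow, map_mul, pow_add]; ring
    rw [this, h, h']
    simp only [Algebra.smul_def, map_add, map_mul, map_pow]
    ring
  algebraMap_mem' := by
    intro a
    refine ⟨⟨0, a, 0, by simp⟩, ?_⟩
    rw [denominatorIdeal_eq_top_iff.2 ⟨a, rfl⟩, top_sup_eq, Ideal.radical_top]
    exact le_top

end Denominators

section LocalLifting

variable {A Q : Type*} [CommRing A] [CommRing Q] [Algebra A Q]


open IsLocalRing

lemma exists_linearMap_of_pow_smul {F : Subalgebra A Q} {t c : A} {y : Q} {N : ℕ}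
    (hinj : Function.Injective (algebraMap A Q)) (hy2 : y ^ 2 = algebraMap A Q c)
    (hc : c ∈ denominatorIdeal A y)
    (q : Ideal A) [q.IsPrime] (hq : denominatorIdeal A y ≤ q)
    (hN : ∀ f ∈ F, ∃ a b : A, t ^ N • f = algebraMap A Q a + b • y) :
    ∃ α β : F →ₗ[A] A ⧸ q,
      (∀ (f : F) a b, t ^ N • (f : Q) = algebraMap A Q a + b • y →
        α f = algebraMap A _ a ∧ β f = algebraMap A _ b) ∧
      (∀ f g, algebraMap A (A ⧸ q) (t ^ N) * α (f * g) = α f * α g) ∧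
      (∀ f g, algebraMap A (A ⧸ q) (t ^ N) * β (f * g) = α f * β g + α g * β f) := by
  have huniq0 : ∀ a b : A, algebraMap A Q a + b • y = 0 → a ∈ q ∧ b ∈ q := by
    intro a b h
    have hb : b ∈ denominatorIdeal A y :=
      mem_denominatorIdeal.2 ⟨-a, by rw [map_neg]; linear_combination -h⟩
    have ha : a ^ 2 = b ^ 2 * c := by
      apply hinj
      rw [Algebra.smul_def] at h
      rw [map_pow, map_mul, map_pow]
      linear_combination (algebraMap A Q a - algebraMap A Q b * y) * h +
        (algebraMap A Q b) ^ 2 * hy2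
    refine ⟨‹q.IsPrime›.mem_of_pow_mem 2 ?_, hq hb⟩
    rw [ha, sq, mul_assoc]
    exact q.mul_mem_right _ (hq hb)
  have huniq : ∀ a b a' b' : A, algebraMap A Q a + b • y = algebraMap A Q a' + b' • y →
      algebraMap A (A ⧸ q) a = algebraMap A _ a' ∧ algebraMap A (A ⧸ q) b = algebraMap A _ b' := by
    intro a b a' b' h
    rw [Ideal.Quotient.algebraMap_eq, Ideal.Quotient.eq, Ideal.Quotient.eq]
    exact huniq0 _ _ (by rw [map_sub, sub_smul]; linear_combination h)
  choose a b hab using fun f : F ↦ hN f f.2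
  have hadd : ∀ f g : F, algebraMap A (A ⧸ q) (a (f + g)) = algebraMap A _ (a f) +
      algebraMap A _ (a g) ∧ algebraMap A (A ⧸ q) (b (f + g)) = algebraMap A _ (b f) +
      algebraMap A _ (b g) := by
    intro f g
    rw [← map_add, ← map_add]
    apply huniq
    rw [← hab, Subalgebra.coe_add, smul_add, hab, hab, map_add, add_smul]
    ring
  have hsmul : ∀ (s : A) (f : F), algebraMap A (A ⧸ q) (a (s • f)) = s • algebraMap A _ (a f) ∧
      algebraMap A (A ⧸ q) (b (s • f)) = s • algebraMap A _ (b f) := by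
    intro s f
    rw [Algebra.smul_def s (algebraMap A (A ⧸ q) _), Algebra.smul_def s (algebraMap A (A ⧸ q) _),
      ← map_mul, ← map_mul]
    apply huniq
    rw [← hab, Subalgebra.coe_smul, smul_comm, hab, smul_add, map_mul, mul_smul, ← Algebra.smul_def]
  refine ⟨⟨⟨fun f ↦ algebraMap A _ (a f), fun f g ↦ (hadd f g).1⟩, fun s f ↦ (hsmul s f).1⟩,
    ⟨⟨fun f ↦ algebraMap A _ (b f), fun f g ↦ (hadd f g).2⟩, fun s f ↦ (hsmul s f).2⟩, ?_, ?_⟩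
  · intro f a' b' h
    exact huniq _ _ _ _ (by rw [← hab, h])
  · have key : ∀ f g : F,
        algebraMap A (A ⧸ q) (t ^ N * a (f * g)) = algebraMap A _ (a f * a g + b f * b g * c) ∧
        algebraMap A (A ⧸ q) (t ^ N * b (f * g)) = algebraMap A _ (a f * b g + a g * b f) := by
      intro f g
      apply huniq
      have e1 : algebraMap A Q (t ^ N * a (f * g)) + (t ^ N * b (f * g)) • y =
          (t ^ N • (f : Q)) * (t ^ N • (g : Q)) := by
        rw [map_mul, mul_smul, ← Algebra.smul_def, ← smul_add, ← hab, Subalgebra.coe_mul,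
          smul_mul_smul_comm, smul_smul]
      rw [e1, hab, hab]
      simp only [Algebra.smul_def, map_add, map_mul]
      linear_combination algebraMap A Q (b f) * algebraMap A Q (b g) * hy2
    have hc0 : algebraMap A (A ⧸ q) c = 0 := Ideal.Quotient.eq_zero_iff_mem.2 (hq hc)
    refine ⟨fun f g ↦ ?_, fun f g ↦ ?_⟩
    · have := (key f g).1
      simp only [map_mul, map_add, hc0, mul_zero, add_zero] at this
      simpa using this
    · have := (key f g).2
      simp only [map_mul, map_add] at this
      simpa using this

/-- The key case of the lifting of seminormality along a non-zero-divisor. -/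
theorem denominatorIdeal_eq_top_of_isSwanSeminormal_quotient [IsNoetherianRing A] [IsLocalRing A]
    (hinj : Function.Injective (algebraMap A Q)) {t : A} (htu : IsUnit (algebraMap A Q t))
    (htn : t ∈ maximalIdeal A) (hS : IsSwanSeminormal (A ⧸ Ideal.span {t}))
    {x : Q} {b c d : A} (hx2 : x ^ 2 = algebraMap A Q c) (hx3 : x ^ 3 = algebraMap A Q b)
    (hdu : IsUnit (algebraMap A Q d)) (hd : d ∈ denominatorIdeal A x)
    (hn : maximalIdeal A ≤ (denominatorIdeal A x ⊔ Ideal.span {t}).radical) :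
    denominatorIdeal A x = ⊤ := by
  have hred : ∀ z : A, z ^ 2 ∈ Ideal.span {t} → z ∈ Ideal.span {t} := by
    have := hS.1
    intro z hz
    rw [← Ideal.Quotient.eq_zero_iff_mem] at hz ⊢
    exact eq_zero_of_sq_eq_zero (by rw [← map_pow, hz])
  have hd0 : d ≠ 0 := by
    rintro rfl
    have : Nontrivial Q := hinj.nontrivial
    rw [map_zero] at hdu
    exact not_isUnit_zero hdu
  by_cases hnt : maximalIdeal A ≤ Ideal.span {t}
  · exact denominatorIdeal_eq_top_of_maximalIdeal_le hinj htu htn hnt hx2 hd0 hd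
  by_contra hne
  obtain ⟨s, hq⟩ := exists_denominatorIdeal_smul_isPrime hne
  set y : Q := s • x with hy
  have hxy : denominatorIdeal A x ≤ denominatorIdeal A y := denominatorIdeal_le_smul s x
  have hy2 : y ^ 2 = algebraMap A Q (s ^ 2 * c) := by
    rw [hy, Algebra.smul_def, mul_pow, hx2, map_mul, map_pow]
  have hy3 : y ^ 3 = algebraMap A Q (s ^ 3 * b) := by
    rw [hy, Algebra.smul_def, mul_pow, hx3, map_mul, map_pow]
  have hny : maximalIdeal A ≤ (denominatorIdeal A y ⊔ Ideal.span {t}).radical :=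
    hn.trans (Ideal.radical_mono (sup_le_sup_right hxy _))
  have hdepth : ∀ {z : Q} {N : ℕ}, t ^ N ∈ denominatorIdeal A z →
      maximalIdeal A ≤ (denominatorIdeal A z ⊔ Ideal.span {t}).radical →
      denominatorIdeal A z = ⊤ := fun h1 h2 ↦
    denominatorIdeal_eq_top_of_le_radical hinj htu htn hnt hred h1 h2
  have htq : t ∉ denominatorIdeal A y := fun h ↦
    hq.ne_top (hdepth (N := 1) (by simpa using h) hny)
  let F : Subalgebra A Q := cuspSaturation (t := t) hy2 (maximalIdeal A)
  have hyF : y ∈ F := ⟨⟨0, 0, 1, by simp⟩, hny⟩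
  have hdF : ∀ z ∈ F, d • z ∈ LinearMap.range (Algebra.linearMap A Q) := by
    rintro z ⟨⟨N, a, b', h⟩, hz⟩
    have : denominatorIdeal A (d • z) = ⊤ := by
      refine hdepth (N := N) ?_ (hz.trans
        (Ideal.radical_mono (sup_le_sup_right (denominatorIdeal_le_smul d z) _)))
      obtain ⟨e, he⟩ := mem_denominatorIdeal.1 (hxy hd)
      refine mem_denominatorIdeal.2 ⟨d * a + b' * e, ?_⟩
      rw [smul_comm, h, smul_add, smul_comm d b', ← he]
      simp only [Algebra.smul_def, map_add, map_mul]
    exact denominatorIdeal_eq_top_iff.1 this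
  have hfin : Module.Finite A F := by
    let ℓ : F →ₗ[A] LinearMap.range (Algebra.linearMap A Q) :=
      LinearMap.codRestrict _ (LinearMap.lsmul A Q d ∘ₗ F.val.toLinearMap) fun z ↦ hdF z z.2
    have hℓ : Function.Injective ℓ := by
      intro z z' h
      have h1 : d • (z : Q) = d • (z' : Q) := congrArg Subtype.val h
      rw [Algebra.smul_def, Algebra.smul_def] at h1
      exact Subtype.ext (hdu.mul_left_cancel h1)
    exact Module.Finite.of_injective ℓ hℓ
  have hdenF : ∀ f : F, denominatorIdeal A f = denominatorIdeal A (f : Q) := by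
    intro f
    ext h
    rw [mem_denominatorIdeal, mem_denominatorIdeal]
    exact exists_congr fun a ↦ by rw [Subtype.ext_iff]; rfl
  have hFt : ∀ f : F, ∀ a : A, algebraMap A Q a = t • (f : Q) → ∃ w, algebraMap A Q w = f := by
    intro f a ha
    have := hdepth (N := 1) (z := f) (by rw [pow_one]; exact mem_denominatorIdeal.2 ⟨a, ha⟩) f.2.2
    exact denominatorIdeal_eq_top_iff.1 this
  have hrad : ∀ g ∈ ((maximalIdeal A).map (algebraMap A F)).radical,
      ∃ a f, g = algebraMap A F a + algebraMap A F t * f := by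
    intro g hg
    refine hS.mem_range_add_of_mem_radical ?_ ?_ (fun f ↦ by rw [hdenF]; exact f.2.2) hg
    · intro a ha
      obtain ⟨f, hf⟩ := Ideal.mem_span_singleton'.1 ha
      have hf' : (f : Q) * algebraMap A Q t = algebraMap A Q a := congrArg Subtype.val hf
      obtain ⟨w, hw⟩ := hFt f a (by rw [← hf', Algebra.smul_def, mul_comm])
      refine Ideal.mem_span_singleton'.2 ⟨w, hinj ?_⟩
      rw [map_mul, hw, hf']
    · intro f hf
      obtain ⟨g, hg⟩ := Ideal.mem_span_singleton'.1 hf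
      have hg' : (g : Q) * algebraMap A Q t = (f : Q) ^ 2 := congrArg Subtype.val hg
      obtain ⟨v, hv⟩ := htu.exists_right_inv
      have hz : t • (v * (f : Q)) = f := by
        rw [Algebra.smul_def, ← mul_assoc, hv, one_mul]
      have hzF : v * (f : Q) ∈ F := by
        obtain ⟨⟨N, a, b', h⟩, hfn⟩ := f.2
        refine ⟨⟨N + 1, a, b', by rw [pow_succ, mul_smul, hz, h]⟩, ?_⟩
        refine le_radical_sup_of_mul_le hfn g.2.2 ?_
        rw [Ideal.mul_le]
        intro h1 hh1 h2 hh2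
        obtain ⟨a1, ha1⟩ := mem_denominatorIdeal.1 hh1
        obtain ⟨a2, ha2⟩ := mem_denominatorIdeal.1 hh2
        rw [Algebra.smul_def] at ha1 ha2
        have e1 : (h2 * a1) ^ 2 = (h1 ^ 2 * h2 * a2) * t := by
          apply hinj
          simp only [map_pow, map_mul, ha1, ha2]
          linear_combination -(algebraMap A Q h1) ^ 2 * (algebraMap A Q h2) ^ 2 * hg'
        obtain ⟨w, hw⟩ := Ideal.mem_span_singleton'.1
          (hred _ (e1 ▸ Ideal.mul_mem_left _ _ (Ideal.mem_span_singleton_self t)))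
        refine mem_denominatorIdeal.2 ⟨w, htu.mul_left_cancel ?_⟩
        have hw' := congrArg (algebraMap A Q) hw
        rw [map_mul, map_mul, ha1] at hw'
        rw [Algebra.smul_def, map_mul]
        rw [Algebra.smul_def] at hz
        linear_combination hw' - algebraMap A Q h1 * algebraMap A Q h2 * hz
      refine Ideal.mem_span_singleton'.2 ⟨⟨_, hzF⟩, Subtype.ext ?_⟩
      change v * (f : Q) * algebraMap A Q t = f
      rw [mul_comm, ← Algebra.smul_def, hz]
  obtain ⟨N, hN⟩ : ∃ N, ∀ f ∈ F, ∃ a b : A, t ^ N • f = algebraMap A Q a + b • y := by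
    have : ∀ M : Submodule A F, M.FG →
        ∃ N, ∀ f ∈ M, ∃ a b : A, t ^ N • (f : Q) = algebraMap A Q a + b • y := by
      intro M hM
      induction M, hM using Submodule.fg_induction with
      | singleton f =>
        obtain ⟨⟨N, a, b', h⟩, -⟩ := f.2
        refine ⟨N, fun g hg ↦ ?_⟩
        obtain ⟨r, rfl⟩ := Submodule.mem_span_singleton.1 hg
        refine ⟨r * a, r * b', ?_⟩
        rw [Subalgebra.coe_smul, smul_comm, h]
        simp only [Algebra.smul_def, map_mul]; ring
      | sup M M' _ _ hM hM' =>
        obtain ⟨N, hN⟩ := hM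
        obtain ⟨N', hN'⟩ := hM'
        refine ⟨N + N', fun g hg ↦ ?_⟩
        obtain ⟨f, hf, f', hf', rfl⟩ := Submodule.mem_sup.1 hg
        obtain ⟨a, b1, h⟩ := hN f hf
        obtain ⟨a', b1', h'⟩ := hN' f' hf'
        refine ⟨t ^ N' * a + t ^ N * a', t ^ N' * b1 + t ^ N * b1', ?_⟩
        simp only [Algebra.smul_def, map_add, map_mul, map_pow, pow_add,
          Subalgebra.coe_add] at h h' ⊢
        linear_combination (algebraMap A Q t) ^ N' * h + (algebraMap A Q t) ^ N * h'
    obtain ⟨N, hN⟩ := this ⊤ Module.Finite.fg_top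
    exact ⟨N, fun f hf ↦ hN ⟨f, hf⟩ trivial⟩
  obtain ⟨α, β, hαβ, hα, hβ⟩ := exists_linearMap_of_pow_smul (F := F) hinj hy2
    (mem_denominatorIdeal.2 ⟨s ^ 3 * b, by rw [← hy3, Algebra.smul_def, ← hy2]; ring⟩)
    (denominatorIdeal A y) le_rfl hN
  have h1 := hαβ 1 (t ^ N) 0 (by simp [Algebra.smul_def])
  have hβy := (hαβ ⟨y, hyF⟩ 0 (t ^ N) (by simp)).2
  refine false_of_derivation_of_radical (N := N) (denominatorIdeal A y) htq htn hny hrad α β h1.1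
    (by simpa using h1.2) hα hβ ?_
  rintro rfl
  rw [LinearMap.zero_apply, eq_comm, Ideal.Quotient.algebraMap_eq,
    Ideal.Quotient.eq_zero_iff_mem] at hβy
  exact htq (hq.mem_of_pow_mem N hβy)

end LocalLifting

section Lifting

variable {A : Type*} [CommRing A]

open IsLocalRing

lemma isReduced_of_isReduced_quotient [IsNoetherianRing A] [IsLocalRing A] {t : A}
    (ht : t ∈ nonZeroDivisors A)
    (htn : t ∈ maximalIdeal A) (hS : IsReduced (A ⧸ Ideal.span {t})) : IsReduced A := by
  refine IsReduced.of_sq_eq_zero fun z hz ↦ ?_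
  have key : ∀ k, ∀ z : A, z ^ 2 = 0 → z ∈ maximalIdeal A ^ k := by
    intro k
    induction k with
    | zero => simp
    | succ k ih =>
      intro z hz
      have h1 : z ∈ Ideal.span {t} := by
        rw [← Ideal.Quotient.eq_zero_iff_mem]
        exact eq_zero_of_sq_eq_zero (by rw [← map_pow, hz, map_zero])
      obtain ⟨w, rfl⟩ := Ideal.mem_span_singleton'.1 h1
      have hw : w ^ 2 = 0 := by
        have : w ^ 2 * (t ^ 2) = 0 := by rw [← mul_pow, hz]
        exact (mul_right_mem_nonZeroDivisors_eq_zero_iff (pow_mem ht 2)).1 this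
      rw [pow_succ]
      exact Ideal.mul_mem_mul (ih w hw) htn
  have := Ideal.iInf_pow_eq_bot_of_isLocalRing (maximalIdeal A) (maximalIdeal.isMaximal A).ne_top
  simpa [this] using (Ideal.mem_iInf.2 fun k ↦ key k z hz : z ∈ ⨅ i, maximalIdeal A ^ i)

lemma cuspDenominators_eq_top_of_le_radical [IsNoetherianRing A] [IsLocalRing A] {t : A}
    (ht : t ∈ nonZeroDivisors A)
    (htn : t ∈ maximalIdeal A) (hS : IsSwanSeminormal (A ⧸ Ideal.span {t})) {b c : A}
    (hbc : b ^ 2 = c ^ 3)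
    (hn : maximalIdeal A ≤ (cuspDenominators b c ⊔ Ideal.span {t}).radical) :
    cuspDenominators b c = ⊤ := by
  have hA : IsReduced A := isReduced_of_isReduced_quotient ht htn hS.1
  let Q := FractionRing A
  have hQ : IsReduced Q := isReduced_localizationPreserves (nonZeroDivisors A) Q hA
  have hinj : Function.Injective (algebraMap A Q) := IsFractionRing.injective A Q
  obtain ⟨x, hx2, hx3⟩ := exists_fractionRing_sq_cube hbc
  have hden : denominatorIdeal A x = cuspDenominators b c := by
    ext h
    rw [mem_denominatorIdeal, mem_cuspDenominators]
    constructor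
    · rintro ⟨a, ha⟩
      rw [Algebra.smul_def] at ha
      have h2 : a ^ 2 = h ^ 2 * c := hinj (by rw [map_pow, ha, mul_pow, hx2, map_mul, map_pow])
      refine ⟨a, hinj ?_, fun r hr ↦ eq_zero_of_sq_eq_zero ?_⟩
      · rw [map_mul, map_mul, ha, ← hx2, ← hx3]; ring
      · linear_combination r ^ 2 * h2 + r * h ^ 2 * hr
    · rintro ⟨a, h1, h2⟩
      obtain ⟨h3, h4⟩ := sq_eq_and_cube_eq_of_mul_eq hbc h1 h2
      refine ⟨a, eq_of_sq_eq_of_cube_eq ?_ ?_⟩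
      · rw [← map_pow, h3, Algebra.smul_def, mul_pow, hx2, map_mul, map_pow]
      · rw [← map_pow, h4, Algebra.smul_def, mul_pow, hx3, map_mul, map_pow]
  obtain ⟨u, r, hr, hd⟩ := exists_mul_add_mem_nonZeroDivisors c
  have hrb : r * b = 0 := eq_zero_of_sq_eq_zero (by linear_combination r ^ 2 * hbc + r * c ^ 2 * hr)
  have hdc : u * c + r ∈ cuspDenominators b c := by
    refine ⟨u * b, by linear_combination -hrb, fun s hs ↦ eq_zero_of_sq_eq_zero ?_⟩
    linear_combination s ^ 2 * u ^ 2 * hbc + s * u ^ 2 * c ^ 2 * hs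
  rw [← hden] at hdc hn ⊢
  exact denominatorIdeal_eq_top_of_isSwanSeminormal_quotient hinj
    (IsLocalization.map_units Q (⟨t, ht⟩ : nonZeroDivisors A)) htn hS hx2 hx3
    (IsLocalization.map_units Q (⟨_, hd⟩ : nonZeroDivisors A)) hdc hn

lemma IsSwanSeminormal.quotient_localization {B : Type*} [CommRing B] [Algebra A B]
    (M : Submonoid A) [IsLocalization M B] {t : A}
    (hS : IsSwanSeminormal (A ⧸ Ideal.span {t})) :
    IsSwanSeminormal (B ⧸ Ideal.span {algebraMap A B t}) := by
  have : (Ideal.span {t}).map (algebraMap A B) = Ideal.span {algebraMap A B t} := by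
    rw [Ideal.map_span, Set.image_singleton]
  rw [← this]
  exact hS.isLocalization (Algebra.algebraMapSubmonoid (A ⧸ Ideal.span {t}) M)

lemma map_mem_nonZeroDivisors_of_isLocalization {B : Type*} [CommRing B] [Algebra A B]
    (M : Submonoid A) [IsLocalization M B] {t : A} (ht : t ∈ nonZeroDivisors A) :
    algebraMap A B t ∈ nonZeroDivisors B :=
  IsLocalization.map_nonZeroDivisors_le M B (Submonoid.mem_map_of_mem _ ht)

lemma IsSwanSeminormal.of_quotient_of_isLocalRing [IsNoetherianRing A] [IsLocalRing A] {t : A}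
    (ht : t ∈ nonZeroDivisors A) (htn : t ∈ maximalIdeal A)
    (hS : IsSwanSeminormal (A ⧸ Ideal.span {t})) : IsSwanSeminormal A := by
  have hA : IsReduced A := isReduced_of_isReduced_quotient ht htn hS.1
  refine ⟨hA, fun b c hbc ↦ ?_⟩
  have htop : cuspDenominators b c ⊔ Ideal.span {t} = ⊤ := by
    by_contra hJ
    obtain ⟨m, hm, hJm⟩ := Ideal.exists_le_maximal _ hJ
    obtain ⟨p, hp, -⟩ := Ideal.exists_minimalPrimes_le hJm
    have hpP := hp.1.1
    have htp : t ∈ p := hp.1.2 (Ideal.mem_sup_right (Ideal.mem_span_singleton_self t))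
    let B := Localization.AtPrime p
    let f := algebraMap A B
    have hB : IsNoetherianRing B := IsLocalization.isNoetherianRing p.primeCompl _ ‹_›
    have htB : f t ∈ maximalIdeal B := (IsLocalization.AtPrime.to_map_mem_maximal_iff B p t).2 htp
    have hle : ∀ h ∈ cuspDenominators b c, f h ∈ cuspDenominators (f b) (f c) := by
      rintro h ⟨a, h1, h2⟩
      refine ⟨f a, by rw [← map_mul, h1, map_mul], fun r hr ↦ ?_⟩
      obtain ⟨⟨r', s⟩, hs⟩ := IsLocalization.surj p.primeCompl r
      simp only at hs
      obtain ⟨v, hv⟩ := (IsLocalization.eq_iff_exists p.primeCompl B).1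
        (show f (r' * c) = f 0 by
          rw [map_mul, ← hs, map_zero, mul_right_comm, hr, zero_mul])
      have h3 : (v : A) * r' * a = 0 := h2 _ (by linear_combination hv)
      have h4 := congrArg f h3
      rw [map_mul, map_mul, ← hs, map_zero] at h4
      have hu := (IsLocalization.map_units B v).mul (IsLocalization.map_units B s)
      refine hu.mul_right_eq_zero.1 ?_
      linear_combination h4
    have hrad : maximalIdeal B ≤ (cuspDenominators (f b) (f c) ⊔ Ideal.span {f t}).radical := by
      rw [Ideal.radical_eq_sInf]
      refine le_sInf ?_
      rintro P ⟨hP, hPp⟩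
      have h1 : p ≤ P.comap f := by
        refine hp.2 ⟨hPp.comap f, sup_le (fun h hh ↦ hP (Ideal.mem_sup_left (hle h hh))) ?_⟩ ?_
        · rw [Ideal.span_singleton_le_iff_mem]
          exact hP (Ideal.mem_sup_right (Ideal.mem_span_singleton_self _))
        · intro a ha
          rw [← IsLocalization.AtPrime.to_map_mem_maximal_iff B p]
          exact le_maximalIdeal hPp.ne_top ha
      rw [← Localization.AtPrime.map_eq_maximalIdeal, Ideal.map_le_iff_le_comap]
      exact h1
    have := cuspDenominators_eq_top_of_le_radical
      (map_mem_nonZeroDivisors_of_isLocalization p.primeCompl ht) htB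
      (hS.quotient_localization p.primeCompl) (by rw [← map_pow, hbc, map_pow]) hrad
    have hBred := isReduced_localizationPreserves p.primeCompl B hA
    obtain ⟨a, h1, h2⟩ := mem_cuspDenominators.1 ((Ideal.eq_top_iff_one _).1 this)
    obtain ⟨⟨a', s⟩, hs⟩ := IsLocalization.surj p.primeCompl a
    simp only at hs
    obtain ⟨h3, h4⟩ := sq_eq_and_cube_eq_of_mul_eq
      (by rw [← map_pow, hbc, map_pow] : f b ^ 2 = f c ^ 3) h1 h2
    obtain ⟨v, hv⟩ := (IsLocalization.eq_iff_exists p.primeCompl B).1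
      (show f (a' ^ 2) = f (s ^ 2 * c) by rw [map_pow, ← hs, mul_pow, h3, map_mul, map_pow]; ring)
    obtain ⟨w, hw⟩ := (IsLocalization.eq_iff_exists p.primeCompl B).1
      (show f (a' ^ 3) = f (s ^ 3 * b) by rw [map_pow, ← hs, mul_pow, h4, map_mul, map_pow]; ring)
    have h5 : (v * w * a' : A) ^ 2 = (v * w * s) ^ 2 * c := by
      linear_combination (v : A) * w ^ 2 * hv
    have h6 : (v * w * a' : A) ^ 3 = (v * w * s) ^ 3 * b := by
      linear_combination (v : A) ^ 3 * w ^ 2 * hw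
    have h7 : (v * w * s : A) ^ 3 ∈ p :=
      hp.1.2 (Ideal.mem_sup_left ⟨_, mul_eq_and_ann_of_sq_eq h5 h6⟩)
    exact (v * w * s).2 (hpP.mem_of_pow_mem 3 h7)
  have htop' : cuspDenominators b c = ⊤ := by
    by_contra h
    exact (maximalIdeal.isMaximal A).ne_top (top_le_iff.1 (htop ▸ sup_le (le_maximalIdeal h)
      ((Ideal.span_singleton_le_iff_mem _).2 htn)))
  obtain ⟨a, h1, h2⟩ := mem_cuspDenominators.1 ((Ideal.eq_top_iff_one _).1 htop')
  obtain ⟨h3, h4⟩ := sq_eq_and_cube_eq_of_mul_eq hbc h1 h2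
  exact ⟨a, by simpa using h3, by simpa using h4⟩

/-- Seminormality lifts along a non-zero-divisor `t`: if `A / t` is seminormal, then `A` is
seminormal at all primes containing `t`. -/
theorem IsSwanSeminormal.at_of_quotient [IsNoetherianRing A] {t : A} (ht : t ∈ nonZeroDivisors A)
    (hS : IsSwanSeminormal (A ⧸ Ideal.span {t})) (P : Ideal A) [P.IsPrime] (htP : t ∈ P) :
    IsSwanSeminormalAt A P := by
  have hB : IsNoetherianRing (Localization.AtPrime P) :=
    IsLocalization.isNoetherianRing P.primeCompl _ ‹_›
  exact (IsSwanSeminormal.of_quotient_of_isLocalRing (A := Localization.AtPrime P)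
    (map_mem_nonZeroDivisors_of_isLocalization P.primeCompl ht)
    ((IsLocalization.AtPrime.to_map_mem_maximal_iff _ P t).2 htP)
    (hS.quotient_localization P.primeCompl)).isSwanSeminormalAt P

end Lifting

section Traverso

variable {A : Type u} [CommRing A]

lemma algebraMap_mem_jacobson_localizationOver_iff {B : Type v} [CommRing B] [Algebra A B]
    [Algebra.IsIntegral A B] (p : Ideal A) [p.IsPrime] (z : B) :
    algebraMap B (LocalizationOver B p) z ∈ (⊥ : Ideal (LocalizationOver B p)).jacobson ↔
      ∀ P : Ideal B, P.IsPrime → P.comap (algebraMap A B) = p → z ∈ P := by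
  have hint : Algebra.IsIntegral (Localization.AtPrime p) (LocalizationOver B p) :=
    ⟨isIntegral_localization⟩
  have hcomap : ∀ M : Ideal (LocalizationOver B p),
      (M.comap (algebraMap B (LocalizationOver B p))).comap (algebraMap A B) =
      (M.comap (algebraMap (Localization.AtPrime p) (LocalizationOver B p))).comap
        (algebraMap A (Localization.AtPrime p)) := by
    intro M
    rw [Ideal.comap_comap, Ideal.comap_comap, ← IsScalarTower.algebraMap_eq,
      ← IsScalarTower.algebraMap_eq]
  have hmem : ∀ w : LocalizationOver B p, w ∈ (⊥ : Ideal (LocalizationOver B p)).jacobson ↔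
      ∀ M : Ideal (LocalizationOver B p), M.IsMaximal → w ∈ M := by
    intro w
    rw [Ideal.jacobson, Submodule.mem_sInf]
    exact ⟨fun h M hM ↦ h M ⟨bot_le, hM⟩, fun h M hM ↦ h M hM.2⟩
  rw [hmem]
  constructor
  · intro h P hP hPp
    have hdisj : Disjoint (Algebra.algebraMapSubmonoid B p.primeCompl : Set B) (P : Set B) := by
      rw [Set.disjoint_left]
      rintro _ ⟨s, hs, rfl⟩ hsP
      exact hs (by rw [← hPp]; exact hsP)
    let M := P.map (algebraMap B (LocalizationOver B p))
    have hMP : M.comap (algebraMap B (LocalizationOver B p)) = P :=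
      IsLocalization.under_map_of_isPrime_disjoint _ _ hP hdisj
    have hMprime : M.IsPrime := IsLocalization.isPrime_of_isPrime_disjoint _ _ P hP hdisj
    have h1 : (M.comap (algebraMap (Localization.AtPrime p) (LocalizationOver B p))) =
        IsLocalRing.maximalIdeal _ := by
      refine le_antisymm (IsLocalRing.le_maximalIdeal (hMprime.comap _).ne_top) ?_
      rw [← Localization.AtPrime.map_eq_maximalIdeal, Ideal.map_le_iff_le_comap, ← hcomap, hMP,
        hPp]
    have hMmax : M.IsMaximal := by
      refine Ideal.isMaximal_of_isIntegral_of_isMaximal_comap (R := Localization.AtPrime p) M ?_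
      rw [h1]; infer_instance
    rw [← hMP]
    exact h M hMmax
  · intro h M hM
    refine h (M.comap _) (hM.isPrime.comap _) ?_
    have := Ideal.isMaximal_comap_of_isIntegral_of_isMaximal (R := Localization.AtPrime p) M
    rw [hcomap, IsLocalRing.eq_maximalIdeal this]
    exact Localization.AtPrime.under_maximalIdeal

theorem IsSeminormalRing.isSwanSeminormal [IsNoetherianRing A] (h : IsSeminormalRing A) :
    IsSwanSeminormal A := by
  have hA := h.1
  refine ⟨hA, fun b c hbc ↦ ?_⟩
  obtain ⟨x, hx2, hx3⟩ := exists_fractionRing_sq_cube hbc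
  have hxint : IsIntegral A x := by
    refine IsIntegral.of_pow (n := 2) (by norm_num) ?_
    rw [hx2]; exact isIntegral_algebraMap
  let y : Normalization A := ⟨x, hxint⟩
  have hy2 : y ^ 2 = algebraMap A (Normalization A) c := Subtype.ext hx2
  have hy3 : y ^ 3 = algebraMap A (Normalization A) b := Subtype.ext hx3
  have hy : y ∈ seminormalizationIn A (Normalization A) := by
    intro p hp
    let B := LocalizationOver (Normalization A) p
    let Ap := Localization.AtPrime p
    by_cases hc : c ∈ p
    · refine ⟨0, algebraMap _ B y, ?_, by rw [map_zero, zero_add]⟩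
      rw [algebraMap_mem_jacobson_localizationOver_iff]
      intro P hP hPp
      refine hP.mem_of_pow_mem 2 ?_
      rw [hy2]
      exact (hPp ▸ hc : c ∈ P.comap (algebraMap A (Normalization A)))
    · refine ⟨IsLocalization.mk' Ap b (⟨c, hc⟩ : p.primeCompl), 0, zero_mem _, ?_⟩
      have hu : IsUnit (algebraMap A B c) := by
        rw [IsScalarTower.algebraMap_apply A Ap B]
        exact (IsLocalization.map_units Ap (⟨c, hc⟩ : p.primeCompl)).map _
      refine hu.mul_right_cancel ?_
      rw [add_zero, IsScalarTower.algebraMap_apply A Ap B, ← map_mul, IsLocalization.mk'_spec,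
        ← IsScalarTower.algebraMap_apply, ← IsScalarTower.algebraMap_apply,
        IsScalarTower.algebraMap_apply A (Normalization A) B,
        IsScalarTower.algebraMap_apply A (Normalization A) B, ← map_mul, ← hy2, ← hy3]
      congr 1; ring
  rw [h.2] at hy
  obtain ⟨a, ha⟩ := Algebra.mem_bot.1 hy
  have hax : algebraMap A (FractionRing A) a = x := congrArg Subtype.val ha
  have hinj := IsFractionRing.injective A (FractionRing A)
  exact ⟨a, hinj (by rw [map_pow, hax, hx2]), hinj (by rw [map_pow, hax, hx3])⟩

lemma exists_of_mem_seminormalizationIn {B : Type v} [CommRing B] [Algebra A B]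
    [Algebra.IsIntegral A B] {y : B} (hy : y ∈ seminormalizationIn A B) (p : Ideal A)
    [p.IsPrime] : ∃ s ∉ p, ∃ a : A, ∀ P : Ideal B, P.IsPrime → P.comap (algebraMap A B) = p →
      s • y - algebraMap A B a ∈ P := by
  obtain ⟨a, j, hj, h⟩ := hy p
  obtain ⟨⟨a', s⟩, hs⟩ := IsLocalization.surj p.primeCompl a
  simp only at hs
  refine ⟨s, s.2, a', ?_⟩
  rw [← algebraMap_mem_jacobson_localizationOver_iff]
  have : algebraMap B (LocalizationOver B p) ((s : A) • y - algebraMap A B a') =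
      algebraMap A (LocalizationOver B p) s * j := by
    rw [map_sub, Algebra.smul_def, map_mul, h, ← IsScalarTower.algebraMap_apply,
      ← IsScalarTower.algebraMap_apply,
      IsScalarTower.algebraMap_apply A (Localization.AtPrime p) (LocalizationOver B p) a', ← hs,
      map_mul, ← IsScalarTower.algebraMap_apply]
    ring
  rw [this]
  exact Ideal.mul_mem_left _ _ hj

theorem IsSwanSeminormal.seminormalizationIn_eq_bot {B : Type v} [CommRing B] [Algebra A B]
    [Algebra.IsIntegral A B] [IsReduced B] (hinj : Function.Injective (algebraMap A B))
    (h : IsSwanSeminormal A) : seminormalizationIn A B = ⊥ := by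
  rw [eq_bot_iff]
  intro y hy
  let F := Algebra.adjoin A {y}
  have hyF : y ∈ F := Algebra.self_mem_adjoin_singleton A y
  let 𝔠 : Ideal F := {
    carrier := {f | ∀ g : F, ((f * g : F) : B) ∈ (algebraMap A B).range}
    zero_mem' := fun g ↦ by rw [zero_mul]; exact zero_mem _
    add_mem' := fun {f f'} hf hf' g ↦ by rw [add_mul]; exact add_mem (hf g) (hf' g)
    smul_mem' := fun s f hf g ↦ by
      rw [smul_eq_mul, mul_comm s, mul_assoc]; exact hf _ }
  have h𝔠 : ∀ {f : F}, f ∈ 𝔠 ↔ ∀ g : F, ((f * g : F) : B) ∈ (algebraMap A B).range := Iff.rfl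
  have hrad : ∀ f : F, ∀ m : ℕ, f ^ m ∈ 𝔠 → f ∈ 𝔠 := by
    intro f m hf
    rw [h𝔠]
    intro g
    refine h.mem_range_of_pow (algebraMap A B) hinj m fun k hk ↦ ?_
    have := h𝔠.1 (Ideal.mem_of_dvd _ (pow_dvd_pow f hk) hf) (g ^ k)
    rwa [← mul_pow] at this
  by_contra hyA
  have hA𝔠 : 𝔠.comap (algebraMap A F) ≠ ⊤ := by
    intro htop
    have h1 : (1 : A) ∈ 𝔠.comap (algebraMap A F) := htop ▸ Submodule.mem_top
    rw [Ideal.mem_comap, map_one, h𝔠] at h1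
    have := h1 ⟨y, hyF⟩
    rw [one_mul] at this
    exact hyA (Algebra.mem_bot.2 this)
  obtain ⟨m, hm, hle⟩ := Ideal.exists_le_maximal _ hA𝔠
  obtain ⟨p, hp, -⟩ := Ideal.exists_minimalPrimes_le hle
  have hpp := hp.1.1
  obtain ⟨s, hs, a, hsa⟩ := exists_of_mem_seminormalizationIn hy p
  let j : F := s • ⟨y, hyF⟩ - algebraMap A F a
  have hjB : (j : B) = s • y - algebraMap A B a := rfl
  -- some multiple of a power of `j` lies in the conductor
  have hex : ∃ u ∉ p, ∃ k : ℕ, algebraMap A F u * j ^ k ∈ 𝔠 := by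
    by_contra! hno
    let T : Submonoid F := Algebra.algebraMapSubmonoid F p.primeCompl ⊔ Submonoid.powers j
    have hdisj : Disjoint (𝔠 : Set F) (T : Set F) := by
      rw [Set.disjoint_right]
      intro f hf
      obtain ⟨_, ⟨u, hu, rfl⟩, _, ⟨k, rfl⟩, rfl⟩ := Submonoid.mem_sup.1 hf
      exact hno u hu k
    obtain ⟨P, hP, h𝔠P, hPd⟩ := Ideal.exists_le_prime_disjoint _ _ hdisj
    have hPp : P.comap (algebraMap A F) = p := by
      have hle : P.comap (algebraMap A F) ≤ p := by
        intro u hu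
        by_contra hup
        exact Set.disjoint_left.1 hPd hu (Submonoid.mem_sup_left ⟨u, hup, rfl⟩)
      exact le_antisymm hle (hp.2 ⟨hP.comap _, Ideal.comap_mono h𝔠P⟩ hle)
    have hker : RingHom.ker (algebraMap F B) ≤ P := by
      rw [(RingHom.injective_iff_ker_eq_bot _).1 Subtype.val_injective]; exact bot_le
    have : Algebra.IsIntegral F B := Algebra.IsIntegral.tower_top A
    obtain ⟨P', -, hP', hPP'⟩ := Ideal.exists_ideal_over_prime_of_isIntegral P (⊥ : Ideal B) hker
    have hj : j ∈ P := by
      rw [← hPP']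
      refine hsa P' hP' ?_
      rw [← hPp, ← hPP', Ideal.comap_comap]; rfl
    exact Set.disjoint_left.1 hPd hj (Submonoid.mem_sup_right (Submonoid.mem_powers j))
  obtain ⟨u, hu, k, huk⟩ := hex
  have hg : algebraMap A F u * j ∈ 𝔠 := by
    refine hrad _ (k + 1) ?_
    have : ∀ x y : F, (x * y) ^ (k + 1) = x * y ^ k * (x ^ k * y) := fun x y ↦ by ring
    rw [this]
    exact Ideal.mul_mem_right _ _ huk
  -- elements of `F` have denominators outside `p`
  have hden : ∀ f : F, ∃ v ∉ p, v • (f : B) ∈ (algebraMap A B).range := by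
    rintro ⟨f, hf⟩
    induction hf using Algebra.adjoin_induction with
    | mem f hf =>
      obtain rfl := hf
      refine ⟨u * s, hpp.mul_notMem hu hs, ?_⟩
      obtain ⟨e, he⟩ := h𝔠.1 hg 1
      refine ⟨e + u * a, ?_⟩
      rw [mul_one] at he
      have he' : algebraMap A B e = algebraMap A B u * (s • f - algebraMap A B a) := he
      rw [map_add, he', map_mul, mul_smul, Algebra.smul_def u, Algebra.smul_def s]
      ring
    | algebraMap r => exact ⟨1, fun h1 ↦ hpp.ne_top (p.eq_top_iff_one.2 h1), r, by simp⟩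
    | add f g _ _ hf hg =>
      obtain ⟨v, hv, e, he⟩ := hf
      obtain ⟨w, hw, e', he'⟩ := hg
      refine ⟨v * w, hpp.mul_notMem hv hw, w * e + v * e', ?_⟩
      simp only [Algebra.smul_def, map_add, map_mul] at he he' ⊢
      rw [he, he']; ring
    | mul f g _ _ hf hg =>
      obtain ⟨v, hv, e, he⟩ := hf
      obtain ⟨w, hw, e', he'⟩ := hg
      refine ⟨v * w, hpp.mul_notMem hv hw, e * e', ?_⟩
      simp only [Algebra.smul_def, map_mul] at he he' ⊢
      rw [he, he']; ring
  have hfin : Module.Finite A F := Algebra.finite_adjoin_simple_of_isIntegral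
    (Algebra.IsIntegral.isIntegral y)
  have hden' : ∀ N : Submodule A F, N.FG →
      ∃ v ∉ p, ∀ f ∈ N, v • (f : B) ∈ (algebraMap A B).range := by
    intro N hN
    induction N, hN using Submodule.fg_induction with
    | singleton f =>
      obtain ⟨v, hv, e, he⟩ := hden f
      refine ⟨v, hv, fun g hg ↦ ?_⟩
      obtain ⟨r, rfl⟩ := Submodule.mem_span_singleton.1 hg
      exact ⟨r * e, by rw [map_mul, he, Subalgebra.coe_smul, smul_comm, Algebra.smul_def r]⟩
    | sup N N' _ _ hN hN' =>
      obtain ⟨v, hv, h1⟩ := hN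
      obtain ⟨w, hw, h2⟩ := hN'
      refine ⟨v * w, hpp.mul_notMem hv hw, fun f hf ↦ ?_⟩
      obtain ⟨g, hg, g', hg', rfl⟩ := Submodule.mem_sup.1 hf
      obtain ⟨e, he⟩ := h1 g hg
      obtain ⟨e', he'⟩ := h2 g' hg'
      refine ⟨w * e + v * e', ?_⟩
      simp only [Algebra.smul_def, map_add, map_mul, Subalgebra.coe_add] at he he' ⊢
      rw [he, he']; ring
  obtain ⟨v, hv, hvF⟩ := hden' ⊤ Module.Finite.fg_top
  refine hv (hp.1.2 ?_)
  rw [Ideal.mem_comap, h𝔠]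
  intro g
  rw [← Algebra.smul_def]
  exact hvF g trivial

theorem IsSwanSeminormal.isSeminormalRing (h : IsSwanSeminormal A) : IsSeminormalRing A := by
  have hA := h.1
  have hQ : IsReduced (FractionRing A) :=
    isReduced_localizationPreserves (nonZeroDivisors A) (FractionRing A) hA
  have : IsReduced (Normalization A) :=
    isReduced_of_injective (integralClosure A (FractionRing A)).val Subtype.val_injective
  refine ⟨hA, h.seminormalizationIn_eq_bot fun a b hab ↦ ?_⟩
  exact IsFractionRing.injective A (FractionRing A) (congrArg Subtype.val hab)

end Traverso

section GenericBasis

/-- A linearly independent set which spans a module up to powers of `g`. -/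
def HasGenericBasis (D : Type*) [CommRing D] (N : Type*) [AddCommGroup N] [Module D N] (g : D) :
    Prop :=
  ∃ s : Set N, LinearIndepOn D id s ∧ ∀ ξ : N, ∃ n : ℕ, g ^ n • ξ ∈ Submodule.span D s

variable {D : Type*} [CommRing D]

lemma HasGenericBasis.of_dvd {N : Type*} [AddCommGroup N] [Module D N] {g g' : D}
    (h : HasGenericBasis D N g) (hg : g ∣ g') : HasGenericBasis D N g' := by
  obtain ⟨s, hs, hsp⟩ := h
  refine ⟨s, hs, fun ξ ↦ ?_⟩
  obtain ⟨n, hn⟩ := hsp ξ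
  obtain ⟨r, rfl⟩ := hg
  refine ⟨n, ?_⟩
  rw [mul_pow, mul_comm, mul_smul]
  exact Submodule.smul_mem _ _ hn

lemma exists_hasGenericBasis_of_finite [IsDomain D] (N : Type*) [AddCommGroup N] [Module D N]
    [Module.Finite D N] : ∃ g : D, g ≠ 0 ∧ HasGenericBasis D N g := by
  classical
  obtain ⟨G, hG⟩ := Module.Finite.fg_top (R := D) (M := N)
  obtain ⟨s, hs, hmax⟩ := exists_maximal_linearIndepOn D ((↑) : G → N)
  choose! a ha0 ha using hmax
  have hx : ∀ i : G, ∃ b : D, b ≠ 0 ∧ b • (i : N) ∈ Submodule.span D ((↑) '' s : Set N) := by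
    intro i
    by_cases hi : i ∈ s
    · exact ⟨1, one_ne_zero, Submodule.smul_mem _ _ (Submodule.subset_span ⟨i, hi, rfl⟩)⟩
    · exact ⟨a i, ha0 i hi, ha i hi⟩
  choose b hb0 hb using hx
  refine ⟨∏ i, b i, Finset.prod_ne_zero_iff.2 fun i _ ↦ hb0 i, ((↑) '' s : Set N),
    hs.id_image, fun ξ ↦ ⟨1, ?_⟩⟩
  rw [pow_one]
  have hξ : ξ ∈ Submodule.span D (G : Set N) := hG ▸ Submodule.mem_top
  induction hξ using Submodule.span_induction with
  | mem x hx =>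
    obtain ⟨r, hr⟩ := Finset.dvd_prod_of_mem b (Finset.mem_univ (⟨x, hx⟩ : G))
    rw [hr, mul_comm, mul_smul]
    exact Submodule.smul_mem _ _ (hb ⟨x, hx⟩)
  | zero => rw [smul_zero]; exact zero_mem _
  | add x y _ _ hx hy => rw [smul_add]; exact add_mem hx hy
  | smul r x _ hx => rw [smul_comm]; exact Submodule.smul_mem _ _ hx

lemma HasGenericBasis.of_filtration {N : Type*} [AddCommGroup N] [Module D N] {g : D}
    (F : ℕ → Submodule D N) (hF0 : F 0 = ⊥) (hF : Monotone F) (htop : ∀ ξ, ∃ j, ξ ∈ F j)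
    (t : ℕ → Set N) (ht : ∀ j, t j ⊆ F (j + 1))
    (hind : ∀ j, LinearIndepOn D (F j).mkQ (t j))
    (hspan : ∀ j, ∀ ξ ∈ F (j + 1), ∃ n : ℕ, g ^ n • ξ ∈ Submodule.span D (t j) ⊔ F j) :
    HasGenericBasis D N g := by
  let U : ℕ → Set N := fun k ↦ ⋃ j < k, t j
  have hUsucc : ∀ k, U (k + 1) = U k ∪ t k := fun k ↦ by
    simp only [U, Nat.lt_succ_iff_lt_or_eq, Set.iUnion_or, Set.iUnion_union_distrib]
    simp
  have hUF : ∀ k, U k ⊆ F k := by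
    intro k x hx
    obtain ⟨j, hj, hx⟩ := Set.mem_iUnion₂.1 hx
    exact hF (Nat.succ_le_of_lt hj) (ht j hx)
  have hUind : ∀ k, LinearIndepOn D id (U k) := by
    intro k
    induction k with
    | zero => simp [U]
    | succ k ih =>
      rw [hUsucc]
      exact LinearIndepOn.union_id_of_quotient (hUF k) ih (hind k)
  have hUspan : ∀ k, ∀ ξ ∈ F k, ∃ n : ℕ, g ^ n • ξ ∈ Submodule.span D (U k) := by
    intro k
    induction k with
    | zero =>
      intro ξ hξ
      rw [hF0, Submodule.mem_bot] at hξ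
      exact ⟨0, by rw [hξ, smul_zero]; exact zero_mem _⟩
    | succ k ih =>
      intro ξ hξ
      obtain ⟨n, hn⟩ := hspan k ξ hξ
      obtain ⟨y, hy, z, hz, hyz⟩ := Submodule.mem_sup.1 hn
      obtain ⟨m, hm⟩ := ih z hz
      refine ⟨m + n, ?_⟩
      rw [pow_add, mul_smul, ← hyz, smul_add, hUsucc, Submodule.span_union]
      exact add_mem (Submodule.smul_mem _ _ (Submodule.mem_sup_right hy))
        (Submodule.mem_sup_left hm)
  have hUmono : Monotone U := fun i j hij ↦
    Set.biUnion_subset_biUnion_left fun l (hl : l < i) ↦ hl.trans_le hij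
  refine ⟨⋃ k, U k, linearIndepOn_iUnion_of_directed hUmono.directed_le hUind, fun ξ ↦ ?_⟩
  obtain ⟨j, hj⟩ := htop ξ
  obtain ⟨n, hn⟩ := hUspan j ξ hj
  exact ⟨n, Submodule.span_mono (Set.subset_iUnion U j) hn⟩

/-- Every finite module over the `D`-algebra `B` has a generic basis. -/
def GenericallyFreeModules (D : Type*) [CommRing D] (B : Type*) [CommRing B] [Algebra D B] :
    Prop :=
  ∀ (N : Type u) [AddCommGroup N] [Module D N] [Module B N] [IsScalarTower D B N]
    [Module.Finite B N], ∃ g : D, g ≠ 0 ∧ HasGenericBasis D N g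

variable {B : Type*} [CommRing B] [Algebra D B]

lemma genericallyFreeModules_of_finite [IsDomain D] [Module.Finite D B] :
    GenericallyFreeModules.{u} D B := fun N _ _ _ _ _ ↦
  have := Module.Finite.trans (R := D) B N
  exists_hasGenericBasis_of_finite N

lemma GenericallyFreeModules.of_surjective {B' : Type*} [CommRing B'] [Algebra D B']
    (h : GenericallyFreeModules.{u} D B) (f : B →ₐ[D] B') (hf : Function.Surjective f) :
    GenericallyFreeModules.{u} D B' := by
  intro N _ _ _ _ _
  let _ : Module B N := Module.compHom N f.toRingHom
  have : IsScalarTower D B N := ⟨fun d b x ↦ by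
    change f (d • b) • x = d • (f b • x)
    rw [map_smul, smul_assoc]⟩
  have : Module.Finite B N := by
    obtain ⟨G, hG⟩ := Module.Finite.fg_top (R := B') (M := N)
    refine ⟨⟨G, Submodule.eq_top_iff'.2 fun x ↦ ?_⟩⟩
    have hx : x ∈ Submodule.span B' (G : Set N) := hG ▸ Submodule.mem_top
    induction hx using Submodule.span_induction with
    | mem x hx => exact Submodule.subset_span hx
    | zero => exact zero_mem _
    | add x y _ _ hx hy => exact add_mem hx hy
    | smul r x _ hx =>
      obtain ⟨b, rfl⟩ := hf r
      exact Submodule.smul_mem _ b hx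
  exact h N

lemma GenericallyFreeModules.polynomial [IsDomain D] [IsNoetherianRing B]
    (h : GenericallyFreeModules.{u} D B) : GenericallyFreeModules.{u} D (Polynomial B) := by
  classical
  intro N _ _ _ _ _
  let _ : Module B N := Module.compHom N Polynomial.C
  have hC : ∀ (b : B) (x : N), b • x = Polynomial.C b • x := fun b x ↦ rfl
  have : IsScalarTower D B N := ⟨fun d b x ↦ by
    rw [hC, hC, ← Polynomial.smul_C, smul_assoc]⟩
  have hX : ∀ (b : B) (j : ℕ) (x : N), (Polynomial.X ^ j : Polynomial B) • b • x =
    b • (Polynomial.X ^ j : Polynomial B) • x := fun b j x ↦ by rw [hC, hC, smul_comm]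
  obtain ⟨G, hG⟩ := Module.Finite.fg_top (R := Polynomial B) (M := N)
  let N₀ : Submodule B N := Submodule.span B (G : Set N)
  have : Module.Finite B N₀ := Module.Finite.iff_fg.2 ⟨G, rfl⟩
  let μ : ℕ → N →ₗ[B] N := fun j ↦
    { toFun := fun x ↦ (Polynomial.X ^ j : Polynomial B) • x
      map_add' := fun x y ↦ smul_add _ _ _
      map_smul' := fun b x ↦ hX b j x }
  have hμ : ∀ j x, μ j x = (Polynomial.X ^ j : Polynomial B) • x := fun j x ↦ rfl
  let F : ℕ → Submodule B N := fun j ↦ ⨆ i : Fin j, N₀.map (μ i)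
  have hFsucc : ∀ j, F (j + 1) = F j ⊔ N₀.map (μ j) := fun j ↦ by
    refine le_antisymm (iSup_le fun i ↦ ?_) (sup_le (iSup_le fun i ↦ ?_) ?_)
    · rcases Nat.lt_succ_iff_lt_or_eq.1 i.2 with hi | hi
      · exact le_sup_of_le_left (le_iSup (fun i : Fin j ↦ N₀.map (μ i)) ⟨i, hi⟩)
      · rw [hi]; exact le_sup_right
    · exact le_iSup (fun i : Fin (j + 1) ↦ N₀.map (μ i)) i.castSucc
    · exact le_iSup (fun i : Fin (j + 1) ↦ N₀.map (μ i)) (Fin.last j)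
  have hFmono : Monotone F := monotone_nat_of_le_succ fun j ↦ hFsucc j ▸ le_sup_left
  have hFX : ∀ j, (F j).map (μ 1) ≤ F (j + 1) := by
    intro j
    rw [Submodule.map_iSup]
    refine iSup_le fun i ↦ ?_
    rw [← Submodule.map_comp]
    have : μ 1 ∘ₗ μ i = μ (i + 1) := LinearMap.ext fun x ↦ by
      rw [LinearMap.comp_apply, hμ, hμ, hμ, ← mul_smul, ← pow_add, add_comm]
    rw [this]
    exact le_iSup (fun i : Fin (j + 1) ↦ N₀.map (μ i)) i.succ
  have hFtop : ∀ ξ, ∃ j, ξ ∈ F j := by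
    intro ξ
    have hξ : ξ ∈ Submodule.span (Polynomial B) (G : Set N) := hG ▸ Submodule.mem_top
    induction hξ using Submodule.span_induction with
    | mem x hx =>
      refine ⟨1, hFsucc 0 ▸ Submodule.mem_sup_right ⟨x, Submodule.subset_span hx, ?_⟩⟩
      rw [hμ, pow_zero, one_smul]
    | zero => exact ⟨0, zero_mem _⟩
    | add x y _ _ hx hy =>
      obtain ⟨i, hi⟩ := hx
      obtain ⟨j, hj⟩ := hy
      exact ⟨max i j, add_mem (hFmono (le_max_left i j) hi) (hFmono (le_max_right i j) hj)⟩
    | smul r x _ hx =>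
      obtain ⟨i, hi⟩ := hx
      induction r using Polynomial.induction_on' with
      | add p q hp hq =>
        obtain ⟨i, hi⟩ := hp
        obtain ⟨j, hj⟩ := hq
        rw [add_smul]
        exact ⟨max i j, add_mem (hFmono (le_max_left i j) hi) (hFmono (le_max_right i j) hj)⟩
      | monomial n a =>
        have key : ∀ n : ℕ, ∃ j, (Polynomial.X ^ n : Polynomial B) • x ∈ F j := by
          intro n
          induction n with
          | zero => exact ⟨i, by rwa [pow_zero, one_smul]⟩
          | succ n ih =>
            obtain ⟨j, hj⟩ := ih
            refine ⟨j + 1, hFX j ⟨_, hj, ?_⟩⟩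
            rw [hμ, ← mul_smul, ← pow_add, add_comm]
        obtain ⟨j, hj⟩ := key n
        refine ⟨j, ?_⟩
        rw [← Polynomial.C_mul_X_pow_eq_monomial, mul_smul]
        exact (F j).smul_mem a hj
  let f : ∀ j, N₀ →ₗ[B] N ⧸ F j := fun j ↦ (F j).mkQ ∘ₗ μ j ∘ₗ N₀.subtype
  have hf : ∀ j (v : N₀), f j v = (F j).mkQ (μ j v) := fun j v ↦ rfl
  have hker : Monotone fun j ↦ LinearMap.ker (f j) := by
    refine monotone_nat_of_le_succ fun j v hv ↦ ?_
    rw [LinearMap.mem_ker, hf, Submodule.mkQ_apply, Submodule.Quotient.mk_eq_zero] at hv ⊢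
    refine hFX j ⟨_, hv, ?_⟩
    rw [hμ, hμ, hμ, ← mul_smul, ← pow_add, add_comm]
  obtain ⟨j₀, hj₀⟩ := monotone_stabilizes_iff_noetherian.2 (inferInstance : IsNoetherian B N₀)
    ⟨_, hker⟩
  have hj₀' : ∀ j, j₀ ≤ j → LinearMap.ker (f j₀) = LinearMap.ker (f j) := hj₀
  have hex : ∀ j, ∃ g : D, g ≠ 0 ∧ HasGenericBasis D (N₀ ⧸ LinearMap.ker (f j)) g := fun j ↦ h _
  choose g' hg'0 hg' using hex
  let g : D := ∏ j ∈ Finset.range (j₀ + 1), g' j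
  have hg0 : g ≠ 0 := Finset.prod_ne_zero_iff.2 fun j _ ↦ hg'0 j
  have hg : ∀ j, HasGenericBasis D (N₀ ⧸ LinearMap.ker (f j)) g := by
    intro j
    rcases le_total j j₀ with hj | hj
    · exact (hg' j).of_dvd (Finset.dvd_prod_of_mem g' (Finset.mem_range.2 (by omega)))
    · rw [← hj₀' j hj]
      exact (hg' j₀).of_dvd (Finset.dvd_prod_of_mem g' (Finset.mem_range.2 (by omega)))
  choose s hs hsp using hg
  let φ : ∀ j, (N₀ ⧸ LinearMap.ker (f j)) →ₗ[B] N ⧸ F j := fun j ↦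
    (LinearMap.ker (f j)).liftQ (f j) le_rfl
  have hφ : ∀ j, Function.Injective (φ j) := fun j ↦ by
    rw [← LinearMap.ker_eq_bot]; exact Submodule.ker_liftQ_eq_bot _ _ _ le_rfl
  let o : ∀ j, (N₀ ⧸ LinearMap.ker (f j)) → N := fun j q ↦ μ j (Quotient.out q : N₀)
  have ho : ∀ j q, (F j).mkQ (o j q) = φ j q := fun j q ↦ by
    conv_rhs => rw [← Quotient.out_eq q]
    rfl
  refine ⟨g, hg0, HasGenericBasis.of_filtration (fun j ↦ (F j).restrictScalars D) ?_
    (fun i j hij ↦ hFmono hij) hFtop (fun j ↦ o j '' s j) ?_ ?_ ?_⟩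
  · simp [F]
  · rintro j _ ⟨q, -, rfl⟩
    exact (hFsucc j).symm.le (Submodule.mem_sup_right ⟨_, (Quotient.out q).2, rfl⟩)
  · intro j
    let ε := Submodule.Quotient.restrictScalarsEquiv D (F j)
    have h1 := (hs j).map_injOn (ε.symm.toLinearMap ∘ₗ (φ j).restrictScalars D)
      (ε.symm.injective.comp (hφ j)).injOn
    refine LinearIndepOn.image_of_comp (o j) ((F j).restrictScalars D).mkQ
      (h1.congr fun q _ ↦ ?_)
    exact congrArg ε.symm (ho j q).symm
  · intro j ξ hξ
    have hξ : ξ ∈ F (j + 1) := hξ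
    rw [hFsucc] at hξ
    obtain ⟨y, hy, _, ⟨v, hv, rfl⟩, rfl⟩ := Submodule.mem_sup.1 hξ
    obtain ⟨n, hn⟩ := hsp j (Submodule.Quotient.mk ⟨v, hv⟩)
    refine ⟨n, ?_⟩
    have h1 : ∀ q ∈ Submodule.span D (s j),
        ∃ w ∈ Submodule.span D (o j '' s j), (F j).mkQ w = φ j q := by
      intro q hq
      induction hq using Submodule.span_induction with
      | mem q hq => exact ⟨o j q, Submodule.subset_span ⟨q, hq, rfl⟩, ho j q⟩
      | zero => exact ⟨0, zero_mem _, by simp⟩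
      | add x y _ _ hx hy =>
        obtain ⟨w, hw, hwx⟩ := hx
        obtain ⟨w', hw', hwy⟩ := hy
        exact ⟨w + w', add_mem hw hw', by rw [map_add, map_add, hwx, hwy]⟩
      | smul r x _ hx =>
        obtain ⟨w, hw, hwx⟩ := hx
        refine ⟨r • w, Submodule.smul_mem _ _ hw, ?_⟩
        rw [LinearMap.map_smul_of_tower, LinearMap.map_smul_of_tower, hwx]
    obtain ⟨w, hw, hwe⟩ := h1 _ hn
    have h2 : g ^ n • μ j v - w ∈ F j := by
      rw [← Submodule.Quotient.mk_eq_zero, Submodule.Quotient.mk_sub, sub_eq_zero]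
      rw [LinearMap.map_smul_of_tower] at hwe
      exact hwe.symm
    rw [Submodule.mem_sup]
    refine ⟨w, hw, g ^ n • y + (g ^ n • μ j v - w), ?_, by rw [smul_add]; abel⟩
    exact add_mem (Submodule.smul_of_tower_mem _ _ hy) h2

theorem genericallyFreeModules_of_finiteType [IsDomain D] [IsNoetherianRing D]
    [Algebra.FiniteType D B] : GenericallyFreeModules.{u} D B := by
  have hpoly : ∀ n : ℕ, GenericallyFreeModules.{u} D (MvPolynomial (Fin n) D) := by
    intro n
    induction n with
    | zero =>
      have : Module.Finite D (MvPolynomial (Fin 0) D) := Module.Finite.of_surjective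
        (Algebra.linearMap D _) (MvPolynomial.C_surjective (Fin 0))
      exact genericallyFreeModules_of_finite
    | succ n ih =>
      exact ih.polynomial.of_surjective (MvPolynomial.finSuccEquiv D n).symm.toAlgHom
        (MvPolynomial.finSuccEquiv D n).symm.surjective
  obtain ⟨n, f, hf⟩ := Algebra.FiniteType.iff_quotient_mvPolynomial''.1
    (inferInstance : Algebra.FiniteType D B)
  exact (hpoly n).of_surjective f hf

theorem exists_pow_smul_eq_zero_of_forall_isMaximal [IsDomain D] [IsNoetherianRing D]
    [IsJacobsonRing D] [Algebra.FiniteType D B] (N : Type u) [AddCommGroup N] [Module D N]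
    [Module B N] [IsScalarTower D B N] [Module.Finite B N] :
    ∃ g : D, g ≠ 0 ∧ ∀ ξ : N, (∀ m : Ideal D, m.IsMaximal → ξ ∈ m • (⊤ : Submodule D N)) →
      ∃ n : ℕ, g ^ n • ξ = 0 := by
  obtain ⟨g, hg0, s, hs, hsp⟩ := genericallyFreeModules_of_finiteType (D := D) (B := B) N
  refine ⟨g, hg0, fun ξ hξ ↦ ?_⟩
  have hm : ∀ m : Ideal D, ∀ η ∈ m • (⊤ : Submodule D N), ∃ n : ℕ, ∃ l ∈ Finsupp.supported D D s,
      (∀ i, l i ∈ m) ∧ Finsupp.linearCombination D id l = g ^ n • η := by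
    intro m η hη
    induction hη using Submodule.smul_induction_on' with
    | smul a ha x _ =>
      obtain ⟨n, hn⟩ := hsp x
      rw [← Set.image_id s, Finsupp.mem_span_image_iff_linearCombination] at hn
      obtain ⟨l, hl, hlx⟩ := hn
      refine ⟨n, a • l, Submodule.smul_mem _ _ hl, fun i ↦ ?_, ?_⟩
      · exact Ideal.mul_mem_right _ _ ha
      · rw [map_smul, hlx, smul_comm]
    | add x _ y _ hx hy =>
      obtain ⟨n, l, hl, hlm, hlx⟩ := hx
      obtain ⟨n', l', hl', hlm', hlx'⟩ := hy
      refine ⟨n + n', g ^ n' • l + g ^ n • l', add_mem (Submodule.smul_mem _ _ hl)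
        (Submodule.smul_mem _ _ hl'), fun i ↦ ?_, ?_⟩
      · exact add_mem (Ideal.mul_mem_left _ _ (hlm i)) (Ideal.mul_mem_left _ _ (hlm' i))
      · rw [map_add, map_smul, map_smul, hlx, hlx', smul_add, pow_add]
        simp only [← mul_smul, mul_comm]
  obtain ⟨n, hn⟩ := hsp ξ
  rw [← Set.image_id s, Finsupp.mem_span_image_iff_linearCombination] at hn
  obtain ⟨l, hl, hlx⟩ := hn
  refine ⟨n, ?_⟩
  have : l = 0 := by
    ext i
    rw [Finsupp.zero_apply]
    by_contra hli
    have hne : g * l i ≠ 0 := mul_ne_zero hg0 hli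
    have : g * l i ∈ (⊥ : Ideal D).jacobson := by
      rw [Ideal.jacobson, Submodule.mem_sInf]
      rintro m ⟨-, hmm⟩
      by_contra hgm
      obtain ⟨n', l', hl', hlm', hlx'⟩ := hm m ξ (hξ m hmm)
      have heq : g ^ n • l' = g ^ n' • l := by
        refine linearIndepOn_iff.1 hs |> fun H ↦ sub_eq_zero.1 (H _ (sub_mem
          (Submodule.smul_mem _ _ hl') (Submodule.smul_mem _ _ hl)) ?_)
        rw [map_sub, map_smul, map_smul, hlx, hlx', ← mul_smul, ← mul_smul, mul_comm, sub_self]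
      have h1 : g ^ n' * l i ∈ m := by
        have := DFunLike.congr_fun heq i
        simp only [Finsupp.smul_apply, smul_eq_mul] at this
        rw [← this]
        exact Ideal.mul_mem_left _ _ (hlm' i)
      rcases hmm.isPrime.mem_or_mem h1 with h2 | h2
      · exact hgm (Ideal.mul_mem_right _ _ (hmm.isPrime.mem_of_pow_mem _ h2))
      · exact hgm (Ideal.mul_mem_left _ _ h2)
    rw [IsJacobsonRing.out (inferInstance) (Ideal.isPrime_bot (α := D)).isRadical] at this
    exact hne this
  rw [← hlx, this, map_zero]

end GenericBasis

section FieldBaseChange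

lemma exists_algHom_ker_eq {k D : Type*} [Field k] [IsAlgClosed k] [CommRing D] [Algebra k D]
    [Algebra.FiniteType k D] (m : Ideal D) [hm : m.IsMaximal] :
    ∃ s : D →ₐ[k] k, RingHom.ker s = m := by
  let _ : Field (D ⧸ m) := Ideal.Quotient.field m
  have : Module.Finite k (D ⧸ m) := finite_of_finite_type_of_isJacobsonRing k (D ⧸ m)
  let e : k ≃ₐ[k] D ⧸ m := AlgEquiv.ofBijective (Algebra.ofId k _)
    (IsAlgClosed.algebraMap_bijective_of_isIntegral (k := k) (K := D ⧸ m))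
  refine ⟨e.symm.toAlgHom.comp (Ideal.Quotient.mkₐ k m), ?_⟩
  ext d
  rw [RingHom.mem_ker]
  change e.symm (Ideal.Quotient.mk m d) = 0 ↔ _
  rw [map_eq_zero_iff _ e.symm.injective, Ideal.Quotient.eq_zero_iff_mem]

variable {k D A : Type*} [Field k] [CommRing D] [Algebra k D] [CommRing A] [Algebra k A]

/-- The specialization `D ⊗[k] A → A` at a `k`-point of `D`. -/
def specialization (A : Type*) [CommRing A] [Algebra k A] (s : D →ₐ[k] k) : D ⊗[k] A →ₐ[k] A :=
  Algebra.TensorProduct.lift ((Algebra.ofId k A).comp s) (AlgHom.id k A)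
    fun _ _ ↦ Commute.all _ _

lemma specialization_one_tmul (s : D →ₐ[k] k) (a : A) : specialization A s (1 ⊗ₜ a) = a := by
  simp [specialization]

lemma sub_specialization_mem (s : D →ₐ[k] k) (x : D ⊗[k] A) :
    x - 1 ⊗ₜ specialization A s x ∈ (RingHom.ker s) • (⊤ : Submodule D (D ⊗[k] A)) := by
  induction x using TensorProduct.induction_on with
  | zero => simp
  | tmul d a =>
    have : d ⊗ₜ[k] a - 1 ⊗ₜ specialization A s (d ⊗ₜ a) =
        (d - algebraMap k D (s d)) • ((1 : D) ⊗ₜ[k] a) := by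
      rw [TensorProduct.smul_tmul', smul_eq_mul, mul_one, TensorProduct.sub_tmul,
        Algebra.algebraMap_eq_smul_one, TensorProduct.smul_tmul]
      simp [specialization, Algebra.ofId_apply, Algebra.smul_def]
    rw [this]
    refine Submodule.smul_mem_smul ?_ trivial
    rw [RingHom.mem_ker, map_sub, AlgHom.commutes, Algebra.algebraMap_self_apply, sub_self]
  | add x y hx hy =>
    rw [map_add, TensorProduct.tmul_add, add_sub_add_comm]
    exact add_mem hx hy

section

variable [IsAlgClosed k] [IsDomain D] [Algebra.FiniteType k D] [Algebra.FiniteType k A]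

lemma isReduced_tensorProduct_of_finiteType [IsReduced A] : IsReduced (D ⊗[k] A) := by
  have : IsNoetherianRing D := Algebra.FiniteType.isNoetherianRing k D
  have : IsJacobsonRing D := isJacobsonRing_of_finiteType (A := k)
  obtain ⟨g, hg0, hg⟩ := exists_pow_smul_eq_zero_of_forall_isMaximal (D := D) (B := D ⊗[k] A)
    (D ⊗[k] A)
  refine IsReduced.of_sq_eq_zero fun z hz ↦ ?_
  obtain ⟨n, hn⟩ := hg z fun m hm ↦ by
    obtain ⟨s, hs⟩ := exists_algHom_ker_eq (k := k) m
    have h1 := sub_specialization_mem s z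
    have h2 : specialization A s z = 0 :=
      eq_zero_of_sq_eq_zero (by rw [← map_pow, hz, map_zero])
    rwa [h2, TensorProduct.tmul_zero, sub_zero, hs] at h1
  exact (smul_eq_zero.1 hn).resolve_left (pow_ne_zero _ hg0)

lemma IsSwanSeminormal.exists_of_tensorProduct_of_finiteType (h : IsSwanSeminormal A)
    {b c : D ⊗[k] A} (hbc : b ^ 2 = c ^ 3) : ∃ g : D, g ≠ 0 ∧ ∃ a : D ⊗[k] A,
      a ^ 2 = (algebraMap D _ g) ^ 2 * c ∧ a ^ 3 = (algebraMap D _ g) ^ 3 * b := by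
  classical
  have hA := h.1
  have := isReduced_tensorProduct_of_finiteType (k := k) (D := D) (A := A)
  have : IsNoetherianRing D := Algebra.FiniteType.isNoetherianRing k D
  have : IsJacobsonRing D := isJacobsonRing_of_finiteType (A := k)
  let B := D ⊗[k] A
  have : IsNoetherianRing B := Algebra.FiniteType.isNoetherianRing D B
  -- generators of the annihilator of `c`
  obtain ⟨G, hG⟩ := IsNoetherian.noetherian (Ideal.span {c}).annihilator
  have hGc : ∀ r : B, r * c = 0 ↔ r ∈ Ideal.span (G : Set B) := fun r ↦ by
    change _ ↔ r ∈ Submodule.span B (G : Set B)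
    rw [hG, Submodule.mem_annihilator_span_singleton, smul_eq_mul]
  let w : B × (G → B) := (c, fun r ↦ r)
  let M := (B × (G → B)) ⧸ Submodule.span B {w}
  obtain ⟨g, hg0, hg⟩ := exists_pow_smul_eq_zero_of_forall_isMaximal (D := D) (B := B) M
  let ξ : M := Submodule.Quotient.mk (b, 0)
  have hsmul : ∀ (m : Ideal D) (x : B), x ∈ m • (⊤ : Submodule D B) →
      ∀ f : B →ₗ[D] M, f x ∈ m • (⊤ : Submodule D M) := fun m x hx f ↦ by
    have := Submodule.mem_map_of_mem (f := f) hx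
    rw [Submodule.map_smul''] at this
    exact Submodule.smul_mono le_rfl le_top this
  obtain ⟨n, hn⟩ := hg ξ fun m hm ↦ by
    obtain ⟨s, hs⟩ := exists_algHom_ker_eq (k := k) m
    let σ := specialization A s
    have hσ : ∀ x : B, σ x = 0 → x ∈ m • (⊤ : Submodule D B) := fun x hx ↦ by
      have h1 := sub_specialization_mem s x
      change x - 1 ⊗ₜ σ x ∈ _ at h1
      rwa [hx, TensorProduct.tmul_zero, sub_zero, hs] at h1
    obtain ⟨a₀, h2, h3⟩ := h.2 (σ b) (σ c) (by rw [← map_pow, ← map_pow, hbc])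
    let a : B := 1 ⊗ₜ a₀
    have ha : σ a = a₀ := specialization_one_tmul s a₀
    let q : (B × (G → B)) →ₗ[D] M := (Submodule.mkQ _).restrictScalars D
    have hξ : ξ = q (b - a * c, fun r ↦ - (a * r)) := by
      refine (Submodule.Quotient.eq _).2 (Submodule.mem_span_singleton.2 ⟨a, ?_⟩)
      ext
      · simp [w]
      · simp only [w, Prod.snd_sub, Prod.smul_snd, Pi.sub_apply, Pi.smul_apply, smul_eq_mul]
        exact (zero_sub (-(a * _)) |>.trans (neg_neg _)).symm
    have hsum : (b - a * c, fun r : G ↦ - (a * r)) = LinearMap.inl D B (G → B) (b - a * c) +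
        ∑ r : G, LinearMap.inr D B (G → B) (LinearMap.single D (fun _ : G ↦ B) r (- (a * r))) := by
      have : ∑ r : G, LinearMap.single D (fun _ : G ↦ B) r (- (a * r)) = fun r : G ↦ - (a * r) :=
        Finset.univ_sum_single fun r : G ↦ - (a * r)
      rw [← map_sum, this]
      simp
    rw [hξ, hsum, map_add, map_sum]
    refine add_mem (hsmul m _ (hσ _ ?_) (q ∘ₗ LinearMap.inl D B (G → B)))
      (sum_mem fun r _ ↦ hsmul m _ (hσ _ ?_) (q ∘ₗ LinearMap.inr D B (G → B) ∘ₗ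
        LinearMap.single D (fun _ : G ↦ B) r))
    · rw [map_sub, map_mul, ha, ← h2, ← h3]; ring
    · have hr : (r : B) * c = 0 := (hGc r).2 (Ideal.subset_span r.2)
      have hσr : σ r * σ c = 0 := by rw [← map_mul, hr, map_zero]
      rw [map_neg, map_mul, ha, neg_eq_zero]
      refine eq_zero_of_sq_eq_zero ?_
      linear_combination σ r ^ 2 * h2 + σ r * hσr
  have hn' : g ^ n • (b, (0 : G → B)) ∈ Submodule.span B {w} := by
    rw [← Submodule.Quotient.mk_eq_zero]; exact hn
  obtain ⟨a, ha⟩ := Submodule.mem_span_singleton.1 hn'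
  have ha1 : a * c = g ^ n • b := congrArg Prod.fst ha
  have ha2 : ∀ r : G, a * r = 0 := fun r ↦ by
    have := congrFun (congrArg Prod.snd ha) r
    simpa [w] using this
  refine ⟨g ^ n, pow_ne_zero _ hg0, a, sq_eq_and_cube_eq_of_mul_eq hbc ?_ fun r hr ↦ ?_⟩
  · rw [mul_comm, ha1, Algebra.smul_def]
  · have hr' := (hGc r).1 hr
    have hle : Ideal.span (G : Set B) ≤ (Ideal.span {a}).annihilator := by
      refine Ideal.span_le.2 fun x hx ↦ ?_
      rw [SetLike.mem_coe, Submodule.mem_annihilator_span_singleton, smul_eq_mul, mul_comm]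
      exact ha2 ⟨x, hx⟩
    have := hle hr'
    rwa [Submodule.mem_annihilator_span_singleton] at this

end

lemma exists_fg_mem_range_map {Ω : Type*} [CommRing Ω] [Algebra k Ω] (x : Ω ⊗[k] A) :
    ∃ D : Subalgebra k Ω, D.FG ∧ ∀ D' : Subalgebra k Ω, D ≤ D' →
      x ∈ (Algebra.TensorProduct.map D'.val (AlgHom.id k A)).range := by
  induction x using TensorProduct.induction_on with
  | zero => exact ⟨⊥, Subalgebra.fg_bot, fun D' _ ↦ zero_mem _⟩
  | tmul d a =>
    refine ⟨Algebra.adjoin k {d}, ⟨{d}, by simp⟩, fun D' hD ↦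
      ⟨⟨d, hD (Algebra.self_mem_adjoin_singleton k d)⟩ ⊗ₜ a, by simp⟩⟩
  | add x y hx hy =>
    obtain ⟨D, hD, h⟩ := hx
    obtain ⟨E, hE, h'⟩ := hy
    exact ⟨D ⊔ E, hD.sup hE, fun D' hD' ↦
      add_mem (h D' (le_sup_left.trans hD')) (h' D' (le_sup_right.trans hD'))⟩

theorem IsSwanSeminormal.tensorProduct_of_isAlgClosed [IsAlgClosed k] [Algebra.FiniteType k A]
    (h : IsSwanSeminormal A) (Ω : Type*) [Field Ω] [Algebra k Ω] :
    IsSwanSeminormal (Ω ⊗[k] A) := by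
  have hA := h.1
  have hinj : ∀ D : Subalgebra k Ω, Function.Injective
      (Algebra.TensorProduct.map D.val (AlgHom.id k A)) := fun D ↦
    Module.Flat.rTensor_preserves_injective_linearMap _ Subtype.val_injective
  have hex : ∀ x y : Ω ⊗[k] A, ∃ D : Subalgebra k Ω, D.FG ∧
      x ∈ (Algebra.TensorProduct.map D.val (AlgHom.id k A)).range ∧
      y ∈ (Algebra.TensorProduct.map D.val (AlgHom.id k A)).range := fun x y ↦ by
    obtain ⟨D, hD, hx⟩ := exists_fg_mem_range_map x
    obtain ⟨E, hE, hy⟩ := exists_fg_mem_range_map y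
    exact ⟨D ⊔ E, hD.sup hE, hx _ le_sup_left, hy _ le_sup_right⟩
  refine ⟨IsReduced.of_sq_eq_zero fun z hz ↦ ?_, fun b c hbc ↦ ?_⟩
  · obtain ⟨D, hD, ⟨z, rfl⟩, -⟩ := hex z z
    have : Algebra.FiniteType k D := D.fg_iff_finiteType.1 hD
    have := isReduced_tensorProduct_of_finiteType (k := k) (D := D) (A := A)
    have hz' : z ^ 2 = 0 := hinj D (by rw [map_zero, map_pow]; exact hz)
    rw [eq_zero_of_sq_eq_zero hz', map_zero]
  · obtain ⟨D, hD, ⟨b, rfl⟩, ⟨c, rfl⟩⟩ := hex b c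
    have : Algebra.FiniteType k D := D.fg_iff_finiteType.1 hD
    have hbc' : b ^ 2 = c ^ 3 := hinj D (by rw [map_pow, map_pow]; exact hbc)
    obtain ⟨g, hg0, a, h2, h3⟩ := h.exists_of_tensorProduct_of_finiteType hbc'
    let ι := Algebra.TensorProduct.map D.val (AlgHom.id k A)
    have hg : ι (algebraMap D _ g) = algebraMap Ω _ (g : Ω) := by
      simp [ι, Algebra.TensorProduct.algebraMap_apply]
    have hg1 : algebraMap Ω (Ω ⊗[k] A) (g : Ω)⁻¹ * algebraMap Ω _ (g : Ω) = 1 := by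
      rw [← map_mul, inv_mul_cancel₀, map_one]
      exact fun h0 ↦ hg0 (Subtype.ext h0)
    refine ⟨algebraMap Ω _ (g : Ω)⁻¹ * ι a, ?_, ?_⟩
    · rw [mul_pow, ← map_pow ι, h2, map_mul, map_pow ι, hg, ← mul_assoc, ← mul_pow, hg1, one_pow,
        one_mul]; rfl
    · rw [mul_pow, ← map_pow ι, h3, map_mul, map_pow ι, hg, ← mul_assoc, ← mul_pow, hg1, one_pow,
        one_mul]; rfl

theorem isSwanSeminormal_tensorProduct_of_isAlgebraic {κ : Type u} {K : Type u} [Field κ]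
    [Field K] [Algebra κ K] [Algebra.IsAlgebraic κ K] {A : Type v} [CommRing A] [Algebra κ A]
    (h : ∀ (L : Type u) [Field L] [Algebra κ L], FiniteDimensional κ L →
      IsSwanSeminormal (L ⊗[κ] A)) : IsSwanSeminormal (K ⊗[κ] A) := by
  have hinj : ∀ D : Subalgebra κ K, Function.Injective
      (Algebra.TensorProduct.map D.val (AlgHom.id κ A)) := fun D ↦
    Module.Flat.rTensor_preserves_injective_linearMap _ Subtype.val_injective
  have hex : ∀ x y : K ⊗[κ] A, ∃ D : Subalgebra κ K, IsSwanSeminormal (D ⊗[κ] A) ∧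
      x ∈ (Algebra.TensorProduct.map D.val (AlgHom.id κ A)).range ∧
      y ∈ (Algebra.TensorProduct.map D.val (AlgHom.id κ A)).range := fun x y ↦ by
    obtain ⟨D, hD, hx⟩ := exists_fg_mem_range_map x
    obtain ⟨E, hE, hy⟩ := exists_fg_mem_range_map y
    refine ⟨D ⊔ E, ?_, hx _ le_sup_left, hy _ le_sup_right⟩
    have : Algebra.FiniteType κ (D ⊔ E : Subalgebra κ K) :=
      (Subalgebra.fg_iff_finiteType _).1 (hD.sup hE)
    have : Algebra.IsIntegral κ (D ⊔ E : Subalgebra κ K) :=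
      Algebra.IsIntegral.of_injective (D ⊔ E : Subalgebra κ K).val Subtype.val_injective
    let _ : Field (D ⊔ E : Subalgebra κ K) :=
      (Subalgebra.isField_of_algebraic (D ⊔ E : Subalgebra κ K)).toField
    exact h (D ⊔ E : Subalgebra κ K) Algebra.IsIntegral.finite
  refine ⟨IsReduced.of_sq_eq_zero fun z hz ↦ ?_, fun b c hbc ↦ ?_⟩
  · obtain ⟨D, hD, ⟨z, rfl⟩, -⟩ := hex z z
    have := hD.1
    have hz' : z ^ 2 = 0 := hinj D (by rw [map_zero, map_pow]; exact hz)
    rw [eq_zero_of_sq_eq_zero hz', map_zero]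
  · obtain ⟨D, hD, ⟨b, rfl⟩, ⟨c, rfl⟩⟩ := hex b c
    have hbc' : b ^ 2 = c ^ 3 := hinj D (by rw [map_pow, map_pow]; exact hbc)
    obtain ⟨a, h2, h3⟩ := hD.2 b c hbc'
    exact ⟨Algebra.TensorProduct.map D.val (AlgHom.id κ A) a, by rw [← map_pow, h2]; rfl,
      by rw [← map_pow, h3]; rfl⟩

/-- A geometrically seminormal algebra of finite type stays seminormal after every field
extension. -/
theorem isSwanSeminormal_tensorProduct_of_finiteDimensional {κ : Type u} [Field κ] {A : Type v}
    [CommRing A] [Algebra κ A] [Algebra.FiniteType κ A]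
    (h : ∀ (L : Type u) [Field L] [Algebra κ L], FiniteDimensional κ L →
      IsSwanSeminormal (L ⊗[κ] A)) (Ω : Type*) [Field Ω] [Algebra κ Ω] :
    IsSwanSeminormal (Ω ⊗[κ] A) := by
  let k := AlgebraicClosure κ
  let K := AlgebraicClosure Ω
  have h1 : IsSwanSeminormal (k ⊗[κ] A) := isSwanSeminormal_tensorProduct_of_isAlgebraic h
  let _ : Algebra k K := (IsAlgClosed.lift : k →ₐ[κ] K).toRingHom.toAlgebra
  have : IsScalarTower κ k K := IsScalarTower.of_algebraMap_eq fun x ↦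
    ((IsAlgClosed.lift : k →ₐ[κ] K).commutes x).symm
  have h2 : IsSwanSeminormal (K ⊗[κ] A) :=
    (h1.tensorProduct_of_isAlgClosed K).of_ringEquiv
      (Algebra.TensorProduct.cancelBaseChange κ k K K A).toRingEquiv
  obtain ⟨ρ, hρ⟩ := LinearMap.exists_leftInverse_of_injective (Algebra.linearMap Ω K)
    (LinearMap.ker_eq_bot.2 (RingHom.injective _))
  have hρ1 : ρ 1 = 1 := by
    have := LinearMap.congr_fun hρ 1
    simpa using this
  let ρ' : K ⊗[κ] A →ₗ[Ω] Ω ⊗[κ] A := TensorProduct.AlgebraTensorModule.map ρ LinearMap.id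
  refine h2.of_retraction
    (Algebra.TensorProduct.map (Algebra.ofId Ω K |>.restrictScalars κ) (AlgHom.id κ A)).toRingHom
    ρ'.toAddMonoidHom (fun a x ↦ ?_) ?_
  · induction a using TensorProduct.induction_on with
    | zero => simp
    | tmul s a =>
      induction x using TensorProduct.induction_on with
      | zero => simp
      | tmul r b =>
        have : ρ (algebraMap Ω K s * r) = s * ρ r := by
          rw [← Algebra.smul_def, map_smul, smul_eq_mul]
        simp [ρ', Algebra.ofId_apply, this]
      | add x y hx hy => rw [mul_add, map_add, hx, hy, map_add, mul_add]
    | add x y hx hy => rw [map_add, add_mul, map_add, hx, hy, add_mul]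
  · change ρ' (1 ⊗ₜ 1) = 1
    simp [ρ', hρ1, Algebra.TensorProduct.one_def]

end FieldBaseChange

section KrullAkizuki

lemma length_ne_top_of_forall_smul_eq_zero {E X : Type*} [CommRing E] [IsNoetherianRing E]
    [AddCommGroup X] [Module E X] [Module.Finite E X]
    (h : ∀ x : X, ∃ r : E, r • x = 0 ∧ IsFiniteLength E (E ⧸ Ideal.span {r})) :
    Module.length E X ≠ ⊤ := by
  rw [Module.length_ne_top_iff, isFiniteLength_iff_isNoetherian_isArtinian]
  refine ⟨inferInstance, ?_⟩
  have key : ∀ N : Submodule E X, N.FG → IsArtinian E N := by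
    intro N hN
    induction N, hN using Submodule.fg_induction with
    | singleton x =>
      obtain ⟨r, hr, hfin⟩ := h x
      have := (isFiniteLength_iff_isNoetherian_isArtinian.1 hfin).2
      let f : (E ⧸ Ideal.span {r}) →ₗ[E] X :=
        (Ideal.span {r}).liftQ (LinearMap.toSpanSingleton E X x) (by
          rw [Ideal.span, Submodule.span_singleton_le_iff_mem]; simpa using hr)
      have hf : LinearMap.range f = Submodule.span E {x} := by
        rw [Submodule.range_liftQ, LinearMap.range_toSpanSingleton]
      rw [← hf]
      infer_instance
    | sup N N' _ _ hN hN' => infer_instance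
  have := key ⊤ Module.Finite.fg_top
  exact isArtinian_of_linearEquiv (Submodule.topEquiv (R := E) (M := X))

lemma ValuationSubring.mem_of_isIntegral {R F : Type*} [CommRing R] [Field F] [Algebra R F]
    (W : ValuationSubring F) (hW : ∀ r, algebraMap R F r ∈ W) {x : F} (hx : IsIntegral R x) :
    x ∈ W := by
  let f : R →+* W := (algebraMap R F).codRestrict W.toSubring hW
  have hx' : IsIntegral W x := by
    obtain ⟨P, hP, hPx⟩ := hx
    refine ⟨P.map f, hP.map f, ?_⟩
    rw [Polynomial.eval₂_map]
    exact hPx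
  obtain ⟨y, hy⟩ := IsIntegrallyClosed.isIntegral_iff.1 hx'
  exact hy ▸ y.2

/-- The Krull-Akizuki theorem for a valuation ring. -/
theorem ValuationSubring.wfDvdMonoid_of_isFiniteLength {E F : Type*} [CommRing E] [IsDomain E]
    [IsNoetherianRing E] [Field F] [Algebra E F] (hinj : Function.Injective (algebraMap E F))
    (hlen : ∀ r : E, r ≠ 0 → IsFiniteLength E (E ⧸ Ideal.span {r}))
    (W : ValuationSubring F) (hW : ∀ r, algebraMap E F r ∈ W) (N : Submodule E F) (hN : N.FG)
    (hNW : ∀ x ∈ N, x ∈ W) (hspan : ∀ f : F, ∃ r : E, r ≠ 0 ∧ r • f ∈ N) : WfDvdMonoid W := by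
  refine ⟨wellFounded_iff_isEmpty_descending_chain.2 ⟨fun ⟨w, hw⟩ ↦ ?_⟩⟩
  have hw0 : ∀ n, w (n + 1) ≠ 0 := fun n ↦ (hw n).1
  -- `e` is a multiple of `w 1` coming from the base
  obtain ⟨e, he0, he⟩ := hspan ((w 1 : F)⁻¹)
  have hw1 : (w 1 : F) ≠ 0 := fun h ↦ hw0 0 (Subtype.ext h)
  let Wm : Submodule E F :=
    { carrier := W
      zero_mem' := zero_mem W
      add_mem' := W.add_mem _ _
      smul_mem' := fun r x hx ↦ by rw [Algebra.smul_def]; exact W.mul_mem _ _ (hW r) hx }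
  let I : ℕ → Submodule E F := fun n ↦ Wm.map (LinearMap.mulLeft E (w (n + 1) : F))
  have heI : Wm.map (LinearMap.lsmul E F e) ≤ I 0 := by
    rintro _ ⟨x, hx, rfl⟩
    refine ⟨(e • (w 1 : F)⁻¹) * x, W.mul_mem _ _ (hNW _ he) hx, ?_⟩
    simp only [LinearMap.mulLeft_apply, LinearMap.lsmul_apply, Algebra.smul_def]
    field_simp
  have hImono : ∀ n, I n ≤ I (n + 1) := by
    rintro n _ ⟨x, hx, rfl⟩
    obtain ⟨-, d, -, hd⟩ := hw (n + 1)
    refine ⟨d * x, W.mul_mem _ _ d.2 hx, ?_⟩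
    simp only [LinearMap.mulLeft_apply, hd, MulMemClass.coe_mul, mul_assoc]
  have hInot : ∀ n, (w (n + 2) : F) ∉ I n := by
    rintro n ⟨y, hy, hyw⟩
    obtain ⟨-, d, hdu, hd⟩ := hw (n + 1)
    apply hdu
    have h0 : (w (n + 2) : F) ≠ 0 := fun h ↦ hw0 (n + 1) (Subtype.ext h)
    refine IsUnit.of_mul_eq_one ⟨y, hy⟩ (Subtype.ext ?_)
    have hd' : (w (n + 1) : F) = w (n + 2) * d := congrArg Subtype.val hd
    rw [LinearMap.mulLeft_apply, hd', mul_assoc] at hyw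
    exact mul_left_cancel₀ h0 (hyw.trans (mul_one _).symm)
  have heinj : Function.Injective (LinearMap.lsmul E F e) := by
    intro x y hxy
    simp only [LinearMap.lsmul_apply, Algebra.smul_def] at hxy
    exact mul_left_cancel₀ (fun h ↦ he0 (hinj (by rw [h, map_zero]))) hxy
  have htors : ∀ P : Submodule E F, P.FG → ∀ Q : Submodule E F,
      (∀ x ∈ P, ∃ r : E, r ≠ 0 ∧ r • x ∈ Q) → Module.length E (P ⧸ Q.comap P.subtype) ≠ ⊤ := by
    intro P hP Q hPQ
    have : Module.Finite E P := Module.Finite.iff_fg.2 hP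
    refine length_ne_top_of_forall_smul_eq_zero fun x ↦ ?_
    obtain ⟨⟨x, hx⟩, rfl⟩ := Submodule.mkQ_surjective _ x
    obtain ⟨r, hr0, hr⟩ := hPQ x hx
    refine ⟨r, ?_, hlen r hr0⟩
    rw [← map_smul, Submodule.mkQ_apply, Submodule.Quotient.mk_eq_zero]
    exact hr
  have hfin : N.smulLength e ≠ ⊤ := htors N hN _ fun x hx ↦ ⟨e, he0, x, hx, rfl⟩
  obtain ⟨ℓ, hℓ⟩ := ENat.ne_top_iff_exists.1 hfin
  let P : Submodule E F := N ⊔ Submodule.span E ((fun n ↦ (w n : F)) '' Set.Iic (ℓ + 2))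
  have hPfg : P.FG := hN.sup (Submodule.fg_span ((Set.finite_Iic _).image _))
  have hPW : P ≤ Wm := sup_le hNW (Submodule.span_le.2 (by rintro _ ⟨n, -, rfl⟩; exact (w n).2))
  have hPlen : Module.length E (P ⧸ (P.map (LinearMap.lsmul E F e)).comap P.subtype) = ℓ := by
    rw [hℓ]
    exact (Submodule.smulLength_eq e heinj le_sup_left
      (htors P hPfg N fun x _ ↦ hspan x)).symm
  have hPI : (P.map (LinearMap.lsmul E F e)).comap P.subtype ≤ (I 0).comap P.subtype :=
    Submodule.comap_mono ((Submodule.map_mono hPW).trans heI)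
  have hcount : ∀ n ≤ ℓ + 1,
      Module.length E (P ⧸ (I n).comap P.subtype) + n ≤ (ℓ : ℕ∞) := by
    intro n
    induction n with
    | zero =>
      intro _
      rw [Nat.cast_zero, add_zero, ← hPlen]
      exact length_quotient_le hPI
    | succ n ih =>
      intro hn
      have h1 := ih (by omega)
      have hlt : (I n).comap P.subtype < (I (n + 1)).comap P.subtype := by
        refine lt_of_le_not_ge (Submodule.comap_mono (hImono n)) fun hle ↦ ?_
        have hmem : (w (n + 2) : F) ∈ P :=
          Submodule.mem_sup_right (Submodule.subset_span ⟨n + 2, Set.mem_Iic.2 (by omega), rfl⟩)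
        exact hInot n (hle (x := ⟨_, hmem⟩) ⟨1, one_mem W, mul_one _⟩)
      have hne : Module.length E (P ⧸ (I n).comap P.subtype) ≠ ⊤ := by
        intro h
        rw [h, top_add] at h1
        exact ENat.natCast_ne_top _ (top_le_iff.1 h1)
      refine le_trans ?_ h1
      rw [Nat.cast_succ, add_comm (n : ℕ∞), ← add_assoc]
      gcongr
      exact Order.add_one_le_of_lt (length_quotient_lt hlt hne)
  have h1 := (le_add_self).trans (hcount (ℓ + 1) le_rfl)
  exact absurd h1 (by norm_cast; omega)

theorem exists_valuationSubring_wfDvdMonoid {F : Type*} [Field F] (A : Subring F)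
    [IsNoetherianRing A] (s : A) (hs : ¬ IsUnit s) (G : Finset F)
    (hG : ∀ x ∈ G, IsIntegral A x)
    (hspan : ∀ f : F, ∃ r : A, r ≠ 0 ∧ r • f ∈ Submodule.span A (G : Set F)) :
    ∃ W : ValuationSubring F, A ≤ W.toSubring ∧ (s : F) ∈ W.nonunits ∧ WfDvdMonoid W := by
  obtain ⟨m, hm, hsm⟩ := Ideal.exists_le_maximal (Ideal.span {s})
    (by rwa [ne_eq, Ideal.span_singleton_eq_top])
  obtain ⟨P, hP, -⟩ := Ideal.exists_minimalPrimes_le hsm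
  have hPp := hP.1.1
  let E := LocalSubring.ofPrime A P
  have hAE : A ≤ E.toSubring := LocalSubring.le_ofPrime A P
  obtain ⟨W, hEW, hloc⟩ := E.exists_le_valuationSubring
  have : IsNoetherianRing E.toSubring :=
    IsLocalization.isNoetherianRing P.primeCompl E.toSubring inferInstance
  have hdim : Ring.KrullDimLE 1 E.toSubring := by
    rw [Ring.krullDimLE_iff, IsLocalization.AtPrime.ringKrullDim_eq_height P E.toSubring]
    exact_mod_cast Ideal.height_le_one_of_isPrincipal_of_mem_minimalPrimes (Ideal.span {s}) _ hP
  refine ⟨W, hAE.trans hEW, ?_, ?_⟩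
  · rw [← SetLike.mem_coe, ← W.image_maximalIdeal]
    refine ⟨⟨s, hEW (hAE s.2)⟩, ?_, rfl⟩
    let s' : E.toSubring := ⟨s, hAE s.2⟩
    have hs' : ¬ IsUnit s' := by
      have : algebraMap A E.toSubring s ∈ IsLocalRing.maximalIdeal E.toSubring :=
        (IsLocalization.AtPrime.to_map_mem_maximal_iff _ P s).2
          (hP.1.2 (Ideal.mem_span_singleton_self s))
      exact this
    exact fun hu ↦ hs' (isUnit_of_map_unit (Subring.inclusion hEW) s' hu)
  · refine W.wfDvdMonoid_of_isFiniteLength (E := E.toSubring) Subtype.val_injective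
      (fun r hr ↦ isFiniteLength_quotient_span_singleton _ (mem_nonZeroDivisors_of_ne_zero hr))
      (fun r ↦ hEW r.2) (Submodule.span E.toSubring (G : Set F))
      (Submodule.fg_span G.finite_toSet) (fun x hx ↦ ?_) fun f ↦ ?_
    · induction hx using Submodule.span_induction with
      | mem x hx => exact W.mem_of_isIntegral (R := A) (fun r ↦ hEW (hAE r.2)) (hG x hx)
      | zero => exact zero_mem W
      | add x y _ _ hx hy => exact add_mem hx hy
      | smul r x _ hx => exact mul_mem (hEW r.2) hx
    · obtain ⟨r, hr0, hr⟩ := hspan f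
      refine ⟨⟨r, hAE r.2⟩, fun h ↦ hr0 ?_, ?_⟩
      · have h0 : (r : F) = 0 := congrArg Subtype.val h
        exact Subtype.ext h0
      have hle : ∀ x ∈ Submodule.span A (G : Set F),
          x ∈ Submodule.span E.toSubring (G : Set F) := fun x hx ↦ by
        induction hx using Submodule.span_induction with
        | mem x hx => exact Submodule.subset_span hx
        | zero => exact zero_mem _
        | add x y _ _ hx hy => exact add_mem hx hy
        | smul r x _ hx => exact Submodule.smul_mem _ (⟨r, hAE r.2⟩ : E.toSubring) hx
      exact hle _ hr

theorem ValuationSubring.isPrincipalIdealRing_comap {L F : Type*} [Field L] [Field F]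
    (f : L →+* F) (W : ValuationSubring F) [h : WfDvdMonoid W] :
    IsPrincipalIdealRing (W.comap f) := by
  let g : W.comap f →+* W := (f.comp (W.comap f).subtype).codRestrict W.toSubring fun x ↦ x.2
  have hg : ∀ x, ((g x : W) : F) = f x := fun x ↦ rfl
  have hwf : WfDvdMonoid (W.comap f) := by
    refine ⟨Subrelation.wf (r := InvImage DvdNotUnit g) ?_ (InvImage.wf g h.wf)⟩
    rintro x y ⟨hx0, d, hd, rfl⟩
    refine ⟨fun h0 ↦ hx0 ?_, g d, fun hu ↦ hd ?_, map_mul g x d⟩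
    · have : f x = 0 := by rw [← hg, h0]; rfl
      exact Subtype.ext ((map_eq_zero f).1 this)
    · obtain ⟨y, hy⟩ := isUnit_iff_exists_inv.1 hu
      have hy' : f d * y = 1 := congrArg Subtype.val hy
      have hd0 : (d : L) ≠ 0 := fun h0 ↦ by
        rw [h0, map_zero, zero_mul] at hy'; exact zero_ne_one hy'
      have hyd : f (d : L)⁻¹ = y := by
        rw [map_inv₀]; exact inv_eq_of_mul_eq_one_right hy'
      refine IsUnit.of_mul_eq_one ⟨(d : L)⁻¹, ?_⟩ (Subtype.ext (mul_inv_cancel₀ hd0))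
      rw [ValuationSubring.mem_comap, hyd]
      exact y.2
  exact ((IsBezout.TFAE (R := W.comap f)).out 3 1).1 hwf

end KrullAkizuki

section Transfer

variable {R S : Type*} [CommRing R] [CommRing S] [Algebra R S]

theorem isSwanSeminormalAt_ker_of_valuationSubring [Module.Flat R S] [Algebra.FiniteType R S]
    {L : Type*} [Field L] [Algebra R L] (V : ValuationSubring L) [Algebra R V]
    [IsScalarTower R V L] [IsPrincipalIdealRing V] (hV : V ≠ ⊤)
    (h : IsSwanSeminormal (IsLocalRing.ResidueField V ⊗[R] S)) {F : Type*} [Field F]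
    (ψ : L ⊗[R] S →+* F) (W : ValuationSubring F) (hVW : ∀ x : V, ψ ((x : L) ⊗ₜ 1) ∈ W)
    (hVm : ∀ x ∈ IsLocalRing.maximalIdeal V, ψ ((x : L) ⊗ₜ 1) ∈ W.nonunits)
    (hSW : ∀ s : S, ψ (1 ⊗ₜ s) ∈ W) [(RingHom.ker ψ).IsPrime] :
    IsSwanSeminormalAt (L ⊗[R] S) (RingHom.ker ψ) := by
  let T := V ⊗[R] S
  let f : V →ₐ[R] L := IsScalarTower.toAlgHom R V L
  let ι : T →ₐ[R] L ⊗[R] S := Algebra.TensorProduct.map f (AlgHom.id R S)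
  have hι : Function.Injective ι :=
    Module.Flat.rTensor_preserves_injective_linearMap f.toLinearMap Subtype.val_injective
  have hιV : ∀ x : V, ι (x ⊗ₜ 1) = (x : L) ⊗ₜ 1 := fun x ↦ by
    rw [Algebra.TensorProduct.map_tmul, map_one]; rfl
  have hW : ∀ x : T, ψ (ι x) ∈ W := by
    intro x
    induction x using TensorProduct.induction_on with
    | zero => rw [map_zero, map_zero]; exact zero_mem W
    | tmul y s =>
      have : y ⊗ₜ[R] s = y ⊗ₜ 1 * 1 ⊗ₜ s := by simp
      rw [this, map_mul, map_mul, hιV]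
      refine mul_mem (hVW y) ?_
      have h1 : ι (1 ⊗ₜ s) = 1 ⊗ₜ s := by
        rw [Algebra.TensorProduct.map_tmul, map_one]; rfl
      rw [h1]
      exact hSW s
    | add x y hx hy => rw [map_add, map_add]; exact add_mem hx hy
  let χ : T →+* W := (ψ.comp ι.toRingHom).codRestrict W.toSubring hW
  let P : Ideal T := (IsLocalRing.maximalIdeal W).comap χ
  have hP : ∀ x, x ∉ P → ι x ∉ RingHom.ker ψ := by
    intro x hx hx0
    apply hx
    have : χ x = 0 := Subtype.ext hx0
    rw [Ideal.mem_comap, this]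
    exact zero_mem _
  obtain ⟨t, ht⟩ := (IsPrincipalIdealRing.principal (IsLocalRing.maximalIdeal V)).principal
  have ht0 : t ≠ 0 := by
    rintro rfl
    apply hV
    rw [eq_top_iff]
    intro x _
    rcases V.mem_or_inv_mem x with hx | hx
    · exact hx
    · by_cases hx0 : x = 0
      · rw [hx0]; exact zero_mem V
      have hu : IsUnit (⟨x⁻¹, hx⟩ : V) := by
        by_contra hu
        have hmem : (⟨x⁻¹, hx⟩ : V) ∈ IsLocalRing.maximalIdeal V := hu
        rw [ht, Submodule.span_zero_singleton, Submodule.mem_bot] at hmem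
        exact inv_ne_zero hx0 (congrArg Subtype.val hmem)
      obtain ⟨y, hy⟩ := isUnit_iff_exists_inv.1 hu
      have hy' : x⁻¹ * y = 1 := congrArg Subtype.val hy
      rw [(inv_mul_eq_one₀ hx0).1 hy']
      exact y.2
  have : IsNoetherianRing T := Algebra.FiniteType.isNoetherianRing V T
  let t' : T := t ⊗ₜ 1
  have ht' : t' ∈ nonZeroDivisors T := by
    refine mem_nonZeroDivisors_iff_right.2 fun x hx ↦ ?_
    have h1 : t • x = 0 := by
      rw [Algebra.smul_def, mul_comm]; exact hx
    exact (smul_eq_zero.1 h1).resolve_left ht0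
  have hquot : IsSwanSeminormal (T ⧸ Ideal.span {t'}) := by
    let g : V →ₐ[R] IsLocalRing.ResidueField V := IsScalarTower.toAlgHom R V _
    have hg : Function.Surjective g := IsLocalRing.residue_surjective
    let π : T →ₐ[R] IsLocalRing.ResidueField V ⊗[R] S :=
      Algebra.TensorProduct.map g (AlgHom.id R S)
    have hπ : Function.Surjective π := TensorProduct.map_surjective hg Function.surjective_id
    have hgker : RingHom.ker g = Ideal.span {t} :=
      IsLocalRing.ker_residue.trans ht
    have hker : RingHom.ker π = Ideal.span {t'} := by
      rw [Algebra.TensorProduct.rTensor_ker g hg, hgker, Ideal.map_span, Set.image_singleton]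
      rfl
    rw [← hker]
    exact h.of_ringEquiv (RingHom.quotientKerEquivOfSurjective hπ).symm
  have htP : t' ∈ P := by
    have h1 : ψ ((t : L) ⊗ₜ 1) ∈ W.nonunits :=
      hVm t (ht ▸ Submodule.mem_span_singleton_self t)
    rw [← hιV, ← SetLike.mem_coe, ← W.image_maximalIdeal] at h1
    obtain ⟨y, hy, hyt⟩ := h1
    have : χ t' = y := Subtype.ext hyt.symm
    rw [Ideal.mem_comap, this]
    exact hy
  have key := hquot.at_of_quotient ht' P htP
  have hmap : ∀ (d : V) (x : T), ι (d • x) = (d : L) • ι x := fun d x ↦ by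
    have h1 : d • x = d ⊗ₜ 1 * x := Algebra.smul_def d x
    have h2 : (d : L) • ι x = (d : L) ⊗ₜ 1 * ι x := Algebra.smul_def (d : L) (ι x)
    rw [h1, h2, map_mul, hιV]
  have hden : ∀ u : L ⊗[R] S, ∃ d : V, d ≠ 0 ∧ ∃ x : T, ι x = (d : L) • u := by
    intro u
    induction u using TensorProduct.induction_on with
    | zero => exact ⟨1, one_ne_zero, 0, by simp⟩
    | tmul y s =>
      obtain ⟨⟨a, d⟩, hd⟩ := IsLocalization.surj (nonZeroDivisors V) y
      refine ⟨d, nonZeroDivisors.ne_zero d.2, a ⊗ₜ s, ?_⟩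
      rw [TensorProduct.smul_tmul', smul_eq_mul, mul_comm]
      exact congrArg (fun z ↦ z ⊗ₜ s) hd.symm
    | add x y hx hy =>
      obtain ⟨d, hd0, x', hx⟩ := hx
      obtain ⟨e, he0, y', hy⟩ := hy
      refine ⟨d * e, mul_ne_zero hd0 he0, e • x' + d • y', ?_⟩
      rw [map_add, hmap, hmap, hx, hy, smul_add, MulMemClass.coe_mul, mul_smul, mul_smul,
        smul_comm (e : L)]
  have hd1 : ∀ d : V, d ≠ 0 → algebraMap L (L ⊗[R] S) (d : L)⁻¹ * algebraMap L _ (d : L) = 1 :=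
    fun d hd ↦ by
      rw [← map_mul, inv_mul_cancel₀ fun h0 ↦ hd (Subtype.ext h0), map_one]
  refine ⟨fun z hz ↦ ?_, fun b c hbc ↦ ?_⟩
  · obtain ⟨d, hd0, x, hx⟩ := hden z
    have hx2 : x ^ 2 = 0 := hι (by rw [map_pow, hx, smul_pow, hz, smul_zero, map_zero])
    obtain ⟨w, hw, hwx⟩ := key.1 x hx2
    refine ⟨ι w, hP w hw, ?_⟩
    have h1 : ι w * ((d : L) • z) = 0 := by rw [← hx, ← map_mul, hwx, map_zero]
    rw [Algebra.smul_def] at h1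
    linear_combination algebraMap L _ (d : L)⁻¹ * h1 - ι w * z * hd1 d hd0
  · obtain ⟨d₁, hd₁, b₁, hb₁⟩ := hden b
    obtain ⟨d₂, hd₂, c₁, hc₁⟩ := hden c
    let d := d₁ * d₂
    have hd0 : d ≠ 0 := mul_ne_zero hd₁ hd₂
    have hb : ι ((d ^ 2 * d₂) • b₁) = algebraMap L _ (d : L) ^ 3 * b := by
      rw [hmap, hb₁, Algebra.smul_def, Algebra.smul_def]
      simp only [d, MulMemClass.coe_mul, SubmonoidClass.coe_pow, map_mul, map_pow]
      ring
    have hc : ι ((d * d₁) • c₁) = algebraMap L _ (d : L) ^ 2 * c := by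
      rw [hmap, hc₁, Algebra.smul_def, Algebra.smul_def]
      simp only [d, MulMemClass.coe_mul, map_mul]
      ring
    have hbc' : ((d ^ 2 * d₂) • b₁) ^ 2 = ((d * d₁) • c₁) ^ 3 := hι (by
      rw [map_pow, map_pow, hb, hc]
      linear_combination algebraMap L _ (d : L) ^ 6 * hbc)
    obtain ⟨w, hw, a, h2, h3⟩ := key.2 _ _ hbc'
    have h2' := congrArg ι h2
    have h3' := congrArg ι h3
    rw [map_mul, map_pow, map_pow, hc] at h2'
    rw [map_mul, map_pow, map_pow, hb] at h3'
    have hu := hd1 d hd0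
    have hu2 : algebraMap L (L ⊗[R] S) (d : L)⁻¹ ^ 2 * algebraMap L _ (d : L) ^ 2 = 1 := by
      rw [← mul_pow, hu, one_pow]
    have hu3 : algebraMap L (L ⊗[R] S) (d : L)⁻¹ ^ 3 * algebraMap L _ (d : L) ^ 3 = 1 := by
      rw [← mul_pow, hu, one_pow]
    refine ⟨ι w, hP w hw, algebraMap L _ (d : L)⁻¹ * ι a, ?_, ?_⟩
    · linear_combination algebraMap L _ (d : L)⁻¹ ^ 2 * h2' + ι w ^ 2 * c * hu2
    · linear_combination algebraMap L _ (d : L)⁻¹ ^ 3 * h3' + ι w ^ 3 * b * hu3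

end Transfer

section FiberInduction

variable {R : Type u} [CommRing R] {S : Type v} [CommRing S] [Algebra R S]

lemma Ideal.exists_smul_eq_algebraMap_residueField (p : Ideal R) [p.IsPrime]
    (k : p.ResidueField) : ∃ b ∉ p, ∃ a : R,
      algebraMap R p.ResidueField b * k = algebraMap R p.ResidueField a := by
  obtain ⟨⟨a, b⟩, h⟩ := IsLocalization.surj (nonZeroDivisors (R ⧸ p)) k
  obtain ⟨a, rfl⟩ := Ideal.Quotient.mk_surjective a
  obtain ⟨b, hb⟩ := b
  obtain ⟨b, rfl⟩ := Ideal.Quotient.mk_surjective b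
  refine ⟨b, fun hbp ↦ nonZeroDivisors.ne_zero hb (Ideal.Quotient.eq_zero_iff_mem.2 hbp), a, ?_⟩
  rw [mul_comm]
  exact h

lemma exists_finset_isIntegral_span (p : Ideal R) [p.IsPrime] (L : Type*) [Field L]
    [Algebra p.ResidueField L] [FiniteDimensional p.ResidueField L] [Algebra R L]
    [IsScalarTower R p.ResidueField L] : ∃ G : Finset L, (∀ x ∈ G, IsIntegral R x) ∧
      ∀ y : L, ∃ r ∉ p, r • y ∈ Submodule.span R (G : Set L) := by
  classical
  let _ : Algebra (R ⧸ p) L :=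
    ((algebraMap p.ResidueField L).comp (algebraMap (R ⧸ p) p.ResidueField)).toAlgebra
  have : IsScalarTower (R ⧸ p) p.ResidueField L := IsScalarTower.of_algebraMap_eq fun _ ↦ rfl
  have : IsScalarTower R (R ⧸ p) L := IsScalarTower.of_algebraMap_eq fun x ↦
    IsScalarTower.algebraMap_apply R p.ResidueField L x
  obtain ⟨G, hG⟩ := Module.Finite.fg_top (R := p.ResidueField) (M := L)
  obtain ⟨y, hy0, hy⟩ := exists_integral_multiples (R ⧸ p) p.ResidueField G
  obtain ⟨r, rfl⟩ := Ideal.Quotient.mk_surjective y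
  have hr : r ∉ p := fun h ↦ hy0 (Ideal.Quotient.eq_zero_iff_mem.2 h)
  have hsmul : ∀ x : L, Ideal.Quotient.mk p r • x = r • x := fun x ↦ algebraMap_smul (R ⧸ p) r x
  refine ⟨G.image (r • ·), fun x hx ↦ ?_, fun x ↦ ?_⟩
  · obtain ⟨z, hz, rfl⟩ := Finset.mem_image.1 hx
    have h1 := hy z hz
    rw [hsmul] at h1
    exact isIntegral_trans _ h1
  · have hx : x ∈ Submodule.span p.ResidueField (G : Set L) := hG ▸ Submodule.mem_top
    induction hx using Submodule.span_induction with
    | mem x hx =>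
      exact ⟨r, hr, Submodule.subset_span (Finset.mem_coe.2 (Finset.mem_image_of_mem _ hx))⟩
    | zero => exact ⟨r, hr, by rw [smul_zero]; exact zero_mem _⟩
    | add x y _ _ hx hy =>
      obtain ⟨a, ha, hx⟩ := hx
      obtain ⟨b, hb, hy⟩ := hy
      refine ⟨a * b, Ideal.IsPrime.mul_notMem ‹_› ha hb, ?_⟩
      rw [smul_add, mul_comm, mul_smul, mul_comm, mul_smul a b y]
      exact add_mem (Submodule.smul_mem _ _ hx) (Submodule.smul_mem _ _ hy)
    | smul k x _ hx =>
      obtain ⟨c, hc, hx⟩ := hx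
      obtain ⟨b, hb, a, hab⟩ := p.exists_smul_eq_algebraMap_residueField k
      refine ⟨b * c, Ideal.IsPrime.mul_notMem ‹_› hb hc, ?_⟩
      have : (b * c) • k • x = a • c • x := by
        have h1 : b • k = a • (1 : p.ResidueField) := by
          rw [Algebra.smul_def, hab, Algebra.smul_def, mul_one]
        rw [mul_comm, mul_smul, ← smul_assoc b, h1, smul_assoc, one_smul, smul_comm]
      rw [this]
      exact Submodule.smul_mem _ _ hx

theorem isSwanSeminormal_tensorProduct_of_isGeometricallySeminormal [Algebra.FiniteType R S]
    (p : Ideal R) [p.IsPrime] (h : IsGeometricallySeminormal p.ResidueField (p.Fiber S))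
    (Ω : Type u) [Field Ω] [Algebra R Ω] (hΩ : RingHom.ker (algebraMap R Ω) = p) :
    IsSwanSeminormal (Ω ⊗[R] S) := by
  let _ : Algebra p.ResidueField Ω := (Ideal.ResidueField.lift p (algebraMap R Ω) hΩ.ge
    fun x hx ↦ by
      refine isUnit_iff_ne_zero.2 fun h0 ↦ hx ?_
      rw [← hΩ]; exact h0).toAlgebra
  have : IsScalarTower R p.ResidueField Ω := IsScalarTower.of_algebraMap_eq fun x ↦
    (Ideal.ResidueField.lift_algebraMap p _ _ _ x).symm
  refine (isSwanSeminormal_tensorProduct_of_finiteDimensional (A := p.Fiber S)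
    (fun L _ _ hL ↦ ?_) Ω).of_ringEquiv
    (Algebra.TensorProduct.cancelBaseChange R p.ResidueField p.ResidueField Ω S).toRingEquiv
  have : IsNoetherianRing (L ⊗[p.ResidueField] p.Fiber S) :=
    Algebra.FiniteType.isNoetherianRing L (L ⊗[p.ResidueField] p.Fiber S)
  exact (h L hL).isSwanSeminormal

lemma ValuationSubring.eq_top_of_isIntegral {L F : Type*} [Field L] [Field F] [Algebra L F]
    [Algebra.IsIntegral L F] (W : ValuationSubring F) (h : ∀ x, algebraMap L F x ∈ W) : W = ⊤ :=
  _root_.eq_top_iff.2 fun x _ ↦ W.mem_of_isIntegral h (Algebra.IsIntegral.isIntegral (R := L) x)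

theorem exists_valuationSubring_tensorProduct [IsNoetherianRing R] [Algebra.FiniteType R S]
    (hmax : ∀ P : Ideal S, P.IsMaximal → (P.comap (algebraMap R S)).IsMaximal)
    (p : Ideal R) [p.IsPrime] (hp : ¬ p.IsMaximal)
    (L : Type*) [Field L] [Algebra p.ResidueField L] [FiniteDimensional p.ResidueField L]
    [Algebra R L] [IsScalarTower R p.ResidueField L] {F : Type*} [Field F]
    (ψ : L ⊗[R] S →+* F) (hsurj : Function.Surjective ψ) :
    ∃ W : ValuationSubring F, W ≠ ⊤ ∧ (∀ s : S, ψ (1 ⊗ₜ s) ∈ W) ∧ WfDvdMonoid W := by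
  classical
  let U := L ⊗[R] S
  let φL : L →+* F := ψ.comp Algebra.TensorProduct.includeLeftRingHom
  let φS : S →+* F := ψ.comp (Algebra.TensorProduct.includeRight : S →ₐ[R] U).toRingHom
  have hψ : ∀ x s, ψ (x ⊗ₜ s) = φL x * φS s := fun x s ↦ by
    change _ = ψ (x ⊗ₜ 1) * ψ (1 ⊗ₜ s)
    rw [← map_mul, Algebra.TensorProduct.tmul_mul_tmul, one_mul, mul_one]
  have hRR : ∀ r, φL (algebraMap R L r) = φS (algebraMap R S r) := fun r ↦ by
    change ψ (algebraMap R L r ⊗ₜ 1) = ψ (1 ⊗ₜ algebraMap R S r)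
    rw [Algebra.algebraMap_eq_smul_one, Algebra.algebraMap_eq_smul_one, TensorProduct.smul_tmul]
  have hker : ∀ r, algebraMap R L r = 0 ↔ r ∈ p := fun r ↦ by
    rw [IsScalarTower.algebraMap_apply R p.ResidueField L, map_eq_zero,
      Ideal.algebraMap_residueField_eq_zero]
  -- the kernel of `S → F`
  let q : Ideal S := RingHom.ker φS
  have hqprime : q.IsPrime := RingHom.ker_isPrime φS
  have hqp : q.comap (algebraMap R S) = p := by
    ext r
    rw [Ideal.mem_comap, RingHom.mem_ker, ← hRR, map_eq_zero, hker]
  have hq : ¬ q.IsMaximal := fun h ↦ hp (hqp ▸ hmax q h)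
  obtain ⟨N, hN, hqN⟩ := Ideal.exists_le_maximal q hqprime.ne_top
  obtain ⟨s₀, hs₀N, hs₀q⟩ := SetLike.exists_of_lt (hqN.lt_of_ne fun h ↦ hq (h ▸ hN))
  let A : Subring F := φS.range
  have hA : IsNoetherianRing S := Algebra.FiniteType.isNoetherianRing R S
  have : IsNoetherianRing A := isNoetherianRing_range φS
  let s : A := ⟨φS s₀, s₀, rfl⟩
  have hs : ¬ IsUnit s := by
    rintro hu
    obtain ⟨⟨_, s₁, rfl⟩, h1⟩ := isUnit_iff_exists_inv.1 hu
    have h2 : φS s₀ * φS s₁ = 1 := congrArg Subtype.val h1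
    have h3 : s₀ * s₁ - 1 ∈ q := by
      rw [RingHom.mem_ker, map_sub, map_mul, h2, map_one, sub_self]
    have h4 : (1 : S) ∈ N := by
      have := sub_mem (Ideal.mul_mem_right s₁ N hs₀N) (hqN h3)
      rwa [sub_sub_cancel] at this
    exact hN.ne_top (N.eq_top_iff_one.2 h4)
  obtain ⟨G, hGint, hGspan⟩ := exists_finset_isIntegral_span p L
  let ρ : R →+* A := φS.rangeRestrict.comp (algebraMap R S)
  have hρ : ∀ r, ((ρ r : A) : F) = φL (algebraMap R L r) := fun r ↦ (hRR r).symm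
  have hGA : ∀ x ∈ G.image φL, IsIntegral A x := by
    intro x hx
    obtain ⟨y, hy, rfl⟩ := Finset.mem_image.1 hx
    exact (hGint y hy).map_of_comp_eq ρ φL (RingHom.ext hρ)
  have hspanL : ∀ x ∈ Submodule.span R (G : Set L),
      φL x ∈ Submodule.span A ((G.image φL : Finset F) : Set F) := by
    intro x hx
    induction hx using Submodule.span_induction with
    | mem x hx =>
      exact Submodule.subset_span (Finset.mem_coe.2 (Finset.mem_image_of_mem _ hx))
    | zero => rw [map_zero]; exact zero_mem _
    | add x y _ _ hx hy => rw [map_add]; exact add_mem hx hy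
    | smul r x _ hx =>
      have : φL (r • x) = ρ r • φL x := by
        rw [Algebra.smul_def, map_mul, ← hρ]; rfl
      rw [this]
      exact Submodule.smul_mem _ _ hx
  have hspan : ∀ f : F, ∃ r : A, r ≠ 0 ∧
      r • f ∈ Submodule.span A ((G.image φL : Finset F) : Set F) := by
    intro f
    obtain ⟨w, rfl⟩ := hsurj f
    induction w using TensorProduct.induction_on with
    | zero => exact ⟨1, one_ne_zero, by rw [map_zero, smul_zero]; exact zero_mem _⟩
    | tmul x s =>
      obtain ⟨r, hr, hrx⟩ := hGspan x
      refine ⟨ρ r, fun h ↦ hr ?_, ?_⟩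
      · have h0 : φL (algebraMap R L r) = 0 := by rw [← hρ, h]; rfl
        exact (hker r).1 ((map_eq_zero φL).1 h0)
      · have : ρ r • ψ (x ⊗ₜ s) = φS.rangeRestrict s • φL (r • x) := by
          rw [hψ, Algebra.smul_def r, map_mul, ← hρ]
          change (ρ r : F) * (φL x * φS s) = φS s * ((ρ r : F) * φL x)
          ring
        rw [this]
        exact Submodule.smul_mem _ _ (hspanL _ hrx)
    | add x y hx hy =>
      obtain ⟨a, ha0, ha⟩ := hx
      obtain ⟨b, hb0, hb⟩ := hy
      refine ⟨a * b, mul_ne_zero ha0 hb0, ?_⟩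
      rw [map_add, smul_add, mul_comm, mul_smul, mul_comm, mul_smul a b (ψ y)]
      exact add_mem (Submodule.smul_mem _ _ ha) (Submodule.smul_mem _ _ hb)
  obtain ⟨W, hAW, hsW, hW⟩ := exists_valuationSubring_wfDvdMonoid A s hs _ hGA hspan
  refine ⟨W, ?_, fun x ↦ hAW ⟨x, rfl⟩, hW⟩
  rintro rfl
  rcases (ValuationSubring.mem_nonunits_iff_or _).1 hsW with h | h
  · exact hs₀q h
  · exact h trivial

theorem isSwanSeminormalAt_ker_of_forall_lt [IsNoetherianRing R] [Module.Flat R S]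
    [Algebra.FiniteType R S]
    (hmax : ∀ P : Ideal S, P.IsMaximal → (P.comap (algebraMap R S)).IsMaximal)
    (p : Ideal R) [p.IsPrime] (hp : ¬ p.IsMaximal)
    (ih : ∀ p₁ : Ideal R, p < p₁ → p₁.IsPrime → ∀ (Ω : Type u) [Field Ω] [Algebra R Ω],
      RingHom.ker (algebraMap R Ω) = p₁ → IsSwanSeminormal (Ω ⊗[R] S))
    (L : Type u) [Field L] [Algebra p.ResidueField L] [FiniteDimensional p.ResidueField L]
    [Algebra R L] [IsScalarTower R p.ResidueField L] {F : Type*} [Field F]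
    (ψ : L ⊗[R] S →+* F) (hsurj : Function.Surjective ψ) [(RingHom.ker ψ).IsPrime] :
    IsSwanSeminormalAt (L ⊗[R] S) (RingHom.ker ψ) := by
  obtain ⟨W, hWtop, hSW, hW⟩ := exists_valuationSubring_tensorProduct hmax p hp L ψ hsurj
  let φL : L →+* F := ψ.comp Algebra.TensorProduct.includeLeftRingHom
  have hker : ∀ r, algebraMap R L r = 0 ↔ r ∈ p := fun r ↦ by
    rw [IsScalarTower.algebraMap_apply R p.ResidueField L, map_eq_zero,
      Ideal.algebraMap_residueField_eq_zero]
  have hRW : ∀ r, φL (algebraMap R L r) ∈ W := fun r ↦ by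
    have : φL (algebraMap R L r) = ψ (1 ⊗ₜ algebraMap R S r) := by
      change ψ (algebraMap R L r ⊗ₜ 1) = _
      rw [Algebra.algebraMap_eq_smul_one, Algebra.algebraMap_eq_smul_one,
        TensorProduct.smul_tmul]
    exact this ▸ hSW _
  let V : ValuationSubring L := W.comap φL
  have hVmem : ∀ x, x ∈ V ↔ φL x ∈ W := fun x ↦ Iff.rfl
  have hRV : ∀ r, algebraMap R L r ∈ V := hRW
  let _ : Algebra R V := ((algebraMap R L).codRestrict V.toSubring hRV).toAlgebra
  have : IsScalarTower R V L := IsScalarTower.of_algebraMap_eq fun _ ↦ rfl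
  have : IsPrincipalIdealRing V := W.isPrincipalIdealRing_comap φL
  have hVtop : V ≠ ⊤ := by
    intro hV
    let _ : Algebra L F := φL.toAlgebra
    have : Algebra.FiniteType L F := by
      let g : L ⊗[R] S →ₐ[L] F := { ψ with commutes' := fun x ↦ rfl }
      exact Algebra.FiniteType.of_surjective (f := g) hsurj
    have : Module.Finite L F := finite_of_finite_type_of_isJacobsonRing L F
    exact hWtop (W.eq_top_of_isIntegral fun x ↦ (hVmem x).1 (hV ▸ ValuationSubring.mem_top x))
  -- the prime of `R` dominated by `V`
  let p₁ : Ideal R := RingHom.ker (algebraMap R (IsLocalRing.ResidueField V))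
  have hp₁ : ∀ r, r ∈ p₁ ↔ algebraMap R V r ∈ IsLocalRing.maximalIdeal V := fun r ↦
    IsLocalRing.residue_eq_zero_iff _
  have hpp₁ : p < p₁ := by
    refine lt_of_le_of_ne (fun r hr ↦ ?_) fun heq ↦ ?_
    · have : algebraMap R V r = 0 := Subtype.ext ((hker r).2 hr)
      rw [hp₁, this]; exact zero_mem _
    · refine hVtop (V.eq_top_of_isIntegral (L := p.ResidueField) fun k ↦ ?_)
      obtain ⟨b, hb, a, hab⟩ := p.exists_smul_eq_algebraMap_residueField k
      have hu : IsUnit (algebraMap R V b) := by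
        by_contra hu
        exact hb (heq ▸ (hp₁ b).2 hu)
      obtain ⟨c, hc⟩ := isUnit_iff_exists_inv.1 hu
      have hc' : algebraMap R L b * c = 1 := congrArg Subtype.val hc
      have h1 : algebraMap R L b * algebraMap p.ResidueField L k = algebraMap R L a := by
        rw [IsScalarTower.algebraMap_apply R p.ResidueField L,
          IsScalarTower.algebraMap_apply R p.ResidueField L a, ← map_mul, hab]
      have h2 : algebraMap p.ResidueField L k = c * algebraMap R L a := by
        rw [← h1, ← mul_assoc, mul_comm (c : L), hc', one_mul]
      rw [h2]
      exact V.mul_mem _ _ c.2 (hRV a)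
  refine isSwanSeminormalAt_ker_of_valuationSubring V hVtop
    (ih p₁ hpp₁ (RingHom.ker_isPrime _) _ rfl) ψ W (fun x ↦ x.2) (fun x hx ↦ ?_) hSW
  change φL x ∈ W.nonunits
  rw [ValuationSubring.mem_nonunits_iff_or]
  by_contra! hcon
  obtain ⟨hx0, hxW⟩ := hcon
  rw [← map_inv₀] at hxW
  have hx0' : (x : L) ≠ 0 := fun h ↦ hx0 (by rw [h, map_zero])
  exact hx (IsUnit.of_mul_eq_one ⟨(x : L)⁻¹, hxW⟩ (Subtype.ext (mul_inv_cancel₀ hx0')))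

theorem isSwanSeminormal_tensorProduct_of_forall_lt [IsNoetherianRing R] [Module.Flat R S]
    [Algebra.FiniteType R S]
    (hmax : ∀ P : Ideal S, P.IsMaximal → (P.comap (algebraMap R S)).IsMaximal)
    (p : Ideal R) [p.IsPrime] (hp : ¬ p.IsMaximal)
    (ih : ∀ p₁ : Ideal R, p < p₁ → p₁.IsPrime → ∀ (Ω : Type u) [Field Ω] [Algebra R Ω],
      RingHom.ker (algebraMap R Ω) = p₁ → IsSwanSeminormal (Ω ⊗[R] S))
    (L : Type u) [Field L] [Algebra p.ResidueField L] [FiniteDimensional p.ResidueField L]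
    [Algebra R L] [IsScalarTower R p.ResidueField L] : IsSwanSeminormal (L ⊗[R] S) := by
  refine isSwanSeminormal_of_forall_isMaximal fun 𝔮 h𝔮 ↦ ?_
  let _ : Field (L ⊗[R] S ⧸ 𝔮) := Ideal.Quotient.field 𝔮
  have hker : RingHom.ker (Ideal.Quotient.mk 𝔮) = 𝔮 := Ideal.mk_ker
  have : (RingHom.ker (Ideal.Quotient.mk 𝔮)).IsPrime := by
    rw [hker]; exact h𝔮.isPrime
  have key := isSwanSeminormalAt_ker_of_forall_lt hmax p hp ih L (Ideal.Quotient.mk 𝔮)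
    Ideal.Quotient.mk_surjective
  rwa [hker] at key

theorem isGeometricallySeminormal_of_forall_isMaximal [IsNoetherianRing R] [Module.Flat R S]
    [Algebra.FiniteType R S]
    (hmax : ∀ P : Ideal S, P.IsMaximal → (P.comap (algebraMap R S)).IsMaximal)
    (hfib : ∀ (m : Ideal R) [m.IsMaximal], IsGeometricallySeminormal m.ResidueField (m.Fiber S))
    (p : Ideal R) [hp : p.IsPrime] : IsGeometricallySeminormal p.ResidueField (p.Fiber S) := by
  induction p using WellFoundedGT.induction generalizing hp with
  | _ p ih =>
    by_cases hpm : p.IsMaximal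
    · exact hfib p
    intro L _ _ hL
    let _ : Algebra R L := ((algebraMap p.ResidueField L).comp (algebraMap R _)).toAlgebra
    have : IsScalarTower R p.ResidueField L := IsScalarTower.of_algebraMap_eq fun _ ↦ rfl
    have h := isSwanSeminormal_tensorProduct_of_forall_lt (S := S) hmax p hpm
      (fun p₁ hlt hp₁ Ω _ _ hΩ ↦
        isSwanSeminormal_tensorProduct_of_isGeometricallySeminormal p₁ (ih p₁ hlt) Ω hΩ) L
    exact (h.of_ringEquiv (Algebra.TensorProduct.cancelBaseChange R p.ResidueField
      p.ResidueField L S).symm.toRingEquiv).isSeminormalRing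

end FiberInduction

theorem mainTheorem5 (R : Type u) (S : Type v) [CommRing R] [CommRing S] [Algebra R S]
    (hR : IsExcellentRing R) (hS : IsExcellentRing S)
    (hflat : Module.Flat R S) (hft : Algebra.FiniteType R S)
    (hmax : ∀ P : Ideal S, P.IsMaximal → (P.comap (algebraMap R S)).IsMaximal)
    (hfib : ∀ (m : Ideal R) [m.IsMaximal], IsGeometricallySeminormal m.ResidueField (m.Fiber S)) :
    IsSeminormalHom R S := by
  have := hR.isNoetherianRing
  exact ⟨hflat, fun p _ ↦ isGeometricallySeminormal_of_forall_isMaximal hmax hfib p⟩
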